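/- Let $r:(0,\pi/2)\to[0,\infty)$ be a non-decreasing function, put $r(0)=\inf_{0<\theta<\pi/2} r(\theta)$ and $U_{\theta,r(\theta)}=\{z\in\mathbb C : |z|>r(\theta),\ |\arg z|<\theta\}$. Let $S(r)$ be the space of functions $\gamma:\bigcup_{0<\theta<\pi/2}U_{\theta,r(\theta)}\to\mathbb C$ that are holomorphic and satisfy $$p_{\theta,\epsilon}(\gamma)=\sup_{z\in U_{\theta,r(\theta)}}|\gamma(z)|e^{-\epsilon|z|}<\infty\qquad\text{for all }\theta\in(0,\pi/2),\ \epsilon>0,$$ with the topology defined by the seminorms $p_{\theta,\epsilon}$. For $\gamma\in S(r)$, let $H_\gamma$ be the operator $$H_\gamma\Big(\sum_{n>r(0)}a_nz^n\Big)=\sum_{n>r(0)}\gamma(n)a_nz^n .$$ For a nonempty bounded open set $V\subset\mathbb C$, let $\mathcal O^\infty_{r(0)}(V)$ be the space of entire functions $f$ with $f^{(j)}(0)=0$ for all integers $0\le j\le r(0)$, normed by $|f|_{L^\infty(V)}$. Let $U\subset\mathbb C$ be a nonempty bounded open set that is star-shaped with respect to $0$, let $\delta>0$, and let $U^\delta=\{z\in\mathbb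 C : \operatorname{dist}(z,U)<\delta\}$. Then: 1. For every $\gamma\in S(r)$ there is $C>0$ such that, for all polynomials $f$ whose derivatives of order $0,\dots,\lfloor r(0)\rfloor$ vanish at $0$, $$|H_\gamma f|_{L^\infty(U)}\le C\,|f|_{L^\infty(U^\delta)};$$ moreover the constants $C=C(\gamma)$ can be chosen so that $\gamma\mapsto C(\gamma)$ is continuous on $S(r)$. 2. For every $\gamma\in S(r)$, $H_\gamma$ is a bounded linear operator from $\mathcal O^\infty_{r(0)}(U^\delta)$ to $\mathcal O^\infty_{r(0)}(U)$, and the map $\gamma\mapsto H_\gamma$ is continuous from $S(r)$ to $\mathcal L\big(\mathcal O^\infty_{r(0)}(U^\delta),\mathcal O^\infty_{r(0)}(U)\big)$ with the operator norm. -/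

import Mathlib

open Set Real
open scoped NNReal

noncomputable section

namespace HolomorphyDefault

/-- The truncated sector `U_{θ,ρ} = {z : |z| > ρ, |arg z| < θ}`. -/
def sector (θ : ℝ) (ρ : ℝ≥0) : Set ℂ := {z | (ρ : ℝ) < ‖z‖ ∧ |Complex.arg z| < θ}

/-- The union of the truncated sectors `U_{θ,r(θ)}`, `0 < θ < π/2`. -/
def symbolDomain (r : Ioo (0 : ℝ) (π / 2) → ℝ≥0) : Set ℂ :=
  ⋃ θ : Ioo (0 : ℝ) (π / 2), sector θ (r θ)

/-- `r(0) = inf r`. -/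
def rZero (r : Ioo (0 : ℝ) (π / 2) → ℝ≥0) : ℝ≥0 := ⨅ θ, r θ

instance nonempty_angle : Nonempty (Ioo (0 : ℝ) (π / 2)) :=
  ⟨⟨π / 4, by constructor <;> linarith [Real.pi_pos]⟩⟩

/-- The integers larger than `r(0)` lie in the domain of the symbols. -/
theorem natCast_mem_symbolDomain {r : Ioo (0 : ℝ) (π / 2) → ℝ≥0} {n : ℕ}
    (h : rZero r < n) : (n : ℂ) ∈ symbolDomain r := by
  obtain ⟨θ, hθ⟩ := exists_lt_of_ciInf_lt h
  refine mem_iUnion.2 ⟨θ, ?_, ?_⟩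
  · simpa using (by exact_mod_cast hθ : (r θ : ℝ) < n)
  · simpa using θ.2.1

/-- The inclusion of `U_{θ,r(θ)}` in the domain of the symbols. -/
def sectorIncl (r : Ioo (0 : ℝ) (π / 2) → ℝ≥0) (θ : Ioo (0 : ℝ) (π / 2))
    (z : sector θ (r θ)) : symbolDomain r := ⟨z, mem_iUnion.2 ⟨θ, z.2⟩⟩

/-- The functions on the union of the `U_{θ,r(θ)}` that are holomorphic and have sub-exponential
growth on each `U_{θ,r(θ)}`. -/
def symbolSubmodule (r : Ioo (0 : ℝ) (π / 2) → ℝ≥0) : Submodule ℂ (symbolDomain r → ℂ) where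
  carrier := {γ | (∃ g : ℂ → ℂ, DifferentiableOn ℂ g (symbolDomain r) ∧
      ∀ z : symbolDomain r, g z = γ z) ∧
    ∀ (θ : Ioo (0 : ℝ) (π / 2)) (ε : {ε : ℝ // 0 < ε}),
      BddAbove (range fun z : sector θ (r θ) =>
        ‖γ (sectorIncl r θ z)‖ * Real.exp (-ε * ‖(z : ℂ)‖))}
  zero_mem' := ⟨⟨0, differentiableOn_const 0, fun _ => rfl⟩, fun θ ε =>
    ⟨0, by rintro _ ⟨z, rfl⟩; simp⟩⟩
  add_mem' := by
    rintro γ₁ γ₂ ⟨⟨g₁, d₁, e₁⟩, b₁⟩ ⟨⟨g₂, d₂, e₂⟩, b₂⟩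
    refine ⟨⟨g₁ + g₂, d₁.add d₂, fun z => by simp [e₁, e₂]⟩, fun θ ε => ?_⟩
    obtain ⟨B₁, h₁⟩ := b₁ θ ε
    obtain ⟨B₂, h₂⟩ := b₂ θ ε
    refine ⟨B₁ + B₂, ?_⟩
    rintro _ ⟨z, rfl⟩
    refine le_trans ?_ (add_le_add (h₁ ⟨z, rfl⟩) (h₂ ⟨z, rfl⟩))
    simp only [Pi.add_apply, ← add_mul]
    gcongr
    exact norm_add_le _ _
  smul_mem' := by
    rintro c γ ⟨⟨g, d, e⟩, b⟩
    refine ⟨⟨c • g, d.const_smul c, fun z => by simp [e]⟩, fun θ ε => ?_⟩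
    obtain ⟨B, h⟩ := b θ ε
    refine ⟨‖c‖ * B, ?_⟩
    rintro _ ⟨z, rfl⟩
    simp only [Pi.smul_apply, norm_smul, mul_assoc]
    exact mul_le_mul_of_nonneg_left (h ⟨z, rfl⟩) (norm_nonneg c)

/-- The space `S(r)` of symbols. It is a type synonym, so that it does not inherit the topology of
pointwise convergence. -/
def SymbolSpace (r : Ioo (0 : ℝ) (π / 2) → ℝ≥0) : Type := symbolSubmodule r

instance (r : Ioo (0 : ℝ) (π / 2) → ℝ≥0) : AddCommGroup (SymbolSpace r) :=
  inferInstanceAs (AddCommGroup (symbolSubmodule r))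

instance (r : Ioo (0 : ℝ) (π / 2) → ℝ≥0) : Module ℂ (SymbolSpace r) :=
  inferInstanceAs (Module ℂ (symbolSubmodule r))

/-- The function on the union of the `U_{θ,r(θ)}` underlying a symbol. -/
def SymbolSpace.toFun {r : Ioo (0 : ℝ) (π / 2) → ℝ≥0} (γ : SymbolSpace r) :
    symbolDomain r → ℂ := γ.1

/-- The seminorm `p_{θ,ε}(γ) = sup {|γ(z) exp(-ε|z|)| : z ∈ U_{θ,r(θ)}}`. -/
def symbolSeminorm (r : Ioo (0 : ℝ) (π / 2) → ℝ≥0) (i : Ioo (0 : ℝ) (π / 2) × {ε : ℝ // 0 < ε}) :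
    Seminorm ℂ (SymbolSpace r) :=
  Seminorm.of
    (fun γ => ⨆ z : sector i.1 (r i.1),
      ‖γ.toFun (sectorIncl r i.1 z)‖ * Real.exp (-i.2 * ‖(z : ℂ)‖))
    (fun γ₁ γ₂ => by
      refine Real.iSup_le (fun z => ?_) (add_nonneg
        (Real.iSup_nonneg fun z => by positivity) (Real.iSup_nonneg fun z => by positivity))
      refine le_trans ?_ (add_le_add (le_ciSup (γ₁.2.2 i.1 i.2) z) (le_ciSup (γ₂.2.2 i.1 i.2) z))
      simp only [← add_mul]
      gcongr
      exact norm_add_le _ _)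
    (fun c γ => by
      rw [Real.mul_iSup_of_nonneg (norm_nonneg c)]
      refine iSup_congr fun z => ?_
      rw [← mul_assoc]
      congr 1
      exact norm_smul c _)

/-- `S(r)` carries the topology defined by the seminorms `p_{θ,ε}`. -/
instance (r : Ioo (0 : ℝ) (π / 2) → ℝ≥0) : TopologicalSpace (SymbolSpace r) :=
  (SeminormFamily.moduleFilterBasis (𝕜 := ℂ) (symbolSeminorm r)).topology

theorem withSeminorms_symbolSeminorm (r : Ioo (0 : ℝ) (π / 2) → ℝ≥0) :
    WithSeminorms (𝕜 := ℂ) (symbolSeminorm r) := ⟨rfl⟩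

/-- The value `γ(n)` of a symbol at an integer `n > r(0)` (and `0` for `n ≤ r(0)`, where `γ` is not
defined and where all the functions considered have no coefficient). -/
def SymbolSpace.atNat {r : Ioo (0 : ℝ) (π / 2) → ℝ≥0} (γ : SymbolSpace r) (n : ℕ) : ℂ :=
  if h : rZero r < n then γ.toFun ⟨n, natCast_mem_symbolDomain h⟩ else 0

/-- `H_γ` on polynomials: `∑ aₙ zⁿ ↦ ∑ γ(n) aₙ zⁿ`. -/
def polyOperator {r : Ioo (0 : ℝ) (π / 2) → ℝ≥0} (γ : SymbolSpace r) (f : Polynomial ℂ) :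
    Polynomial ℂ :=
  ∑ n ∈ f.support, Polynomial.monomial n (γ.atNat n * f.coeff n)

/-- The sup norm of `f` on `V`; it is used only for continuous functions and bounded open `V`,
where it is the `L^∞(V)` norm. -/
def supNorm (V : Set ℂ) (f : ℂ → ℂ) : ℝ := ⨆ z : V, ‖f z‖

/-- Nonempty bounded open subsets of `ℂ`. -/
structure BddOpen where
  carrier : Set ℂ
  isOpen : IsOpen carrier
  isBounded : Bornology.IsBounded carrier
  nonempty : carrier.Nonempty

/-- `U^δ = {z : dist(z, U) < δ}`. -/
def BddOpen.thickening (U : BddOpen) (δ : ℝ) (hδ : 0 < δ) : BddOpen where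
  carrier := Metric.thickening δ U.carrier
  isOpen := Metric.isOpen_thickening
  isBounded := U.isBounded.thickening
  nonempty := U.nonempty.mono (Metric.self_subset_thickening hδ _)

/-- `O_{r(0)}`: entire functions all of whose derivatives of order `j ≤ r(0)` vanish at `0`. -/
def entireSubmodule (r : Ioo (0 : ℝ) (π / 2) → ℝ≥0) : Submodule ℂ (ℂ → ℂ) where
  carrier := {f | Differentiable ℂ f ∧ ∀ j : ℕ, (j : ℝ≥0) ≤ rZero r → iteratedDeriv j f 0 = 0}
  zero_mem' := ⟨differentiable_const 0, fun j _ => by simp⟩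
  add_mem' := by
    rintro f g ⟨hf, hf'⟩ ⟨hg, hg'⟩
    refine ⟨hf.add hg, fun j hj => ?_⟩
    rw [iteratedDeriv_add hf.contDiff.contDiffAt hg.contDiff.contDiffAt, hf' j hj, hg' j hj,
      add_zero]
  smul_mem' := by
    rintro c f ⟨hf, hf'⟩
    refine ⟨hf.const_smul c, fun j hj => ?_⟩
    rw [iteratedDeriv_const_smul hf.contDiff.contDiffAt c, hf' j hj, smul_zero]

/-- The space `O_{r(0)}^∞(U)`: the space `O_{r(0)}`, with the sup norm on `U`. It is a type
synonym, so that it does not inherit the topology of pointwise convergence. -/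
def EntireSpace (r : Ioo (0 : ℝ) (π / 2) → ℝ≥0) (_U : BddOpen) : Type := entireSubmodule r

variable (r : Ioo (0 : ℝ) (π / 2) → ℝ≥0) (U : BddOpen)

instance : AddCommGroup (EntireSpace r U) := inferInstanceAs (AddCommGroup (entireSubmodule r))

instance : Module ℂ (EntireSpace r U) := inferInstanceAs (Module ℂ (entireSubmodule r))

/-- The entire function underlying an element of `O_{r(0)}^∞(U)`. -/
def EntireSpace.toFun {r : Ioo (0 : ℝ) (π / 2) → ℝ≥0} {U : BddOpen} (f : EntireSpace r U) :
    ℂ → ℂ := f.1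

instance : Norm (EntireSpace r U) := ⟨fun f => supNorm U.carrier f.toFun⟩

theorem bddAbove_norm (f : ℂ → ℂ) (hf : Continuous f) :
    BddAbove (range fun z : U.carrier => ‖f z‖) := by
  obtain ⟨B, hB⟩ := U.isBounded.isCompact_closure.bddAbove_image (f := fun z => ‖f z‖)
    hf.norm.continuousOn
  refine ⟨B, ?_⟩
  rintro _ ⟨z, rfl⟩
  exact hB ⟨z, subset_closure z.2, rfl⟩

theorem normCore : NormedSpace.Core ℂ (EntireSpace r U) where
  norm_nonneg f := Real.iSup_nonneg fun z => norm_nonneg _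
  norm_smul c f := by
    change (⨆ z : U.carrier, ‖(c • f.toFun) z‖) = ‖c‖ * ⨆ z : U.carrier, ‖f.toFun z‖
    rw [Real.mul_iSup_of_nonneg (norm_nonneg c)]
    exact iSup_congr fun z => norm_smul c _
  norm_triangle f g := by
    refine Real.iSup_le (fun z => ?_) (add_nonneg
      (Real.iSup_nonneg fun z => norm_nonneg _) (Real.iSup_nonneg fun z => norm_nonneg _))
    exact (norm_add_le _ _).trans (add_le_add
      (le_ciSup (bddAbove_norm U f.toFun f.2.1.continuous) z)
      (le_ciSup (bddAbove_norm U g.toFun g.2.1.continuous) z))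
  norm_eq_zero_iff f := by
    constructor
    · intro h
      have hz : ∀ z ∈ U.carrier, f.toFun z = 0 := fun z hz => by
        have := le_ciSup (bddAbove_norm U f.toFun f.2.1.continuous) ⟨z, hz⟩
        exact norm_le_zero_iff.1 (this.trans (le_of_eq h))
      obtain ⟨z₀, h₀⟩ := U.nonempty
      have hana : AnalyticOnNhd ℂ f.toFun univ := fun z _ => f.2.1.analyticAt z
      have h0 : f.toFun = 0 := hana.eq_of_eventuallyEq (fun z _ => analyticAt_const) (z₀ := z₀)
        (Filter.eventually_of_mem (U.isOpen.mem_nhds h₀) hz)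
      exact Subtype.ext h0
    · rintro rfl
      change (⨆ z : U.carrier, ‖(0 : ℂ)‖) = 0
      simp

instance : NormedAddCommGroup (EntireSpace r U) := NormedAddCommGroup.ofCore (normCore r U)

instance : NormedSpace ℂ (EntireSpace r U) := NormedSpace.ofCore (normCore r U)

end HolomorphyDefault

end

/-! The values `γ(n)` are recovered from Cauchy's formula on an infinite sector, and summing that
formula against `aₙ zⁿ` turns `H_γ f` into integrals of `f` along logarithmic spirals that stay in
`U^δ`.

Fix a small `τ`, an integer `N ≥ r(θ)` with `tan θ = 1/τ`, and `a = N + 1/2`. The translate `g(s) =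
γ(a + s)` is holomorphic near the closed sector bounded by the rays `s = ρ(τ ± i)`. For `m = n - a >
0`, `integral_ray_sub_integral_ray` writes `2πi g(m)` as a difference of integrals of `g(s) exp(-η(s
- m)) / (m - s)` over the two rays; the exponential factor equals `1` at `s = m` and beats the
sub-exponential growth of `g`.

On the ray of sign `v = ±1` put `κ = 1 + iτv`. Then `sκ` is purely imaginary and `1/(m - s) = κ ∫
exp((s - m)κu) du` over `u > 0`. Summed over `n`, the kernel becomes an integral of `f(exp(η - uκ)
z)` against an explicit exponential (`norm_sum_exp_div_le`). For small `τ` and `η` the spiral point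
`exp(η - uκ) z` is close to `exp(-u) z`, which lies in `U` by star-shapedness, so it lies in `U^δ`
(`spiral_mul_mem_thickening`). Convergence at `u = ∞` needs a zero of order `N + 1` at `0`, so the
terms of degree at most `N` are removed and estimated by Cauchy's inequalities
(`norm_eval_polyTail_le`, `norm_coeff_le`).

The resulting constant is a finite combination of continuous bounds in `γ` vanishing at `γ = 0`.
Taylor polynomials carry the estimate to entire functions, and additivity in `γ` turns it into
continuity of `γ ↦ H_γ`. -/

namespace HolomorphyDefault

open Filter Topology MeasureTheory

/-! ### Cauchy's theorem and a residue computation on an infinite sector -/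

/-- An open sector with vertex `-1/4`. -/
def openSector (τ : ℝ) : Set ℂ := {s | |s.im| * τ < s.re + 1 / 4}

theorem isOpen_openSector (τ : ℝ) : IsOpen (openSector τ) :=
  isOpen_lt (by fun_prop) (by fun_prop)

theorem convex_openSector {τ : ℝ} (hτ : 0 < τ) : Convex ℝ (openSector τ) := by
  intro x hx y hy a b ha hb hab
  simp only [openSector, mem_ofPred_eq, Complex.add_im, Complex.add_re, Complex.real_smul,
    Complex.mul_re, Complex.mul_im, Complex.ofReal_re, Complex.ofReal_im, zero_mul, sub_zero,
    add_zero] at *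
  have h1 : |a * x.im + b * y.im| ≤ a * |x.im| + b * |y.im| := by
    refine (abs_add_le _ _).trans ?_
    rw [abs_mul, abs_mul, abs_of_nonneg ha, abs_of_nonneg hb]
  have h2 : |a * x.im + b * y.im| * τ ≤ a * (|x.im| * τ) + b * (|y.im| * τ) := by
    nlinarith
  have h3 : a * (|x.im| * τ) + b * (|y.im| * τ) < a * (x.re + 1 / 4) + b * (y.re + 1 / 4) := by
    rcases ha.eq_or_lt with rfl | ha'
    · have : b = 1 := by linarith
      subst this; linarith
    · have := mul_lt_mul_of_pos_left hx ha'
      have := mul_le_mul_of_nonneg_left hy.le hb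
      linarith
  nlinarith

/-- On the boundary rays `|v| = 1` one has `|im| * τ = re`; the margin `1/4` keeps them inside the
open sector, vertex `0` included. -/
theorem mem_openSector_of_abs_le_one {τ : ℝ} (hτ : 0 < τ) {R v : ℝ} (hR : 0 ≤ R) (hv : |v| ≤ 1) :
    (R : ℂ) * (τ + v * Complex.I) ∈ openSector τ := by
  simp only [openSector, mem_ofPred_eq, Complex.mul_im, Complex.mul_re, Complex.add_im,
    Complex.add_re, Complex.ofReal_re, Complex.ofReal_im, Complex.I_re, Complex.I_im, mul_zero,
    mul_one, zero_mul, sub_zero, add_zero, zero_add, abs_mul, abs_of_nonneg hR]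
  have : R * |v| ≤ R * 1 := by gcongr
  nlinarith

/-- Cauchy's theorem for an infinite sector. -/
theorem tendsto_integral_ray_sub_integral_ray {τ : ℝ} (hτ : 0 < τ) {F : ℂ → ℂ}
    (hF : DifferentiableOn ℂ F (openSector τ)) {B : ℝ → ℝ}
    (hB : Tendsto (fun R => R * B R) atTop (𝓝 0))
    (hFB : ∀ᶠ R : ℝ in atTop, ∀ v : ℝ, |v| ≤ 1 → ‖F (R * (τ + v * Complex.I))‖ ≤ B R) :
    Tendsto (fun R : ℝ => (∫ ρ in (0 : ℝ)..R, F (ρ * (τ + (1 : ℝ) * Complex.I)) * (τ + (1 : ℝ) * Complex.I)) -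
      ∫ ρ in (0 : ℝ)..R, F (ρ * (τ + (-1 : ℝ) * Complex.I)) * (τ + (-1 : ℝ) * Complex.I))
      atTop (𝓝 0) := by
  -- Convexity supplies a primitive, so only its values at the far ends of the two rays matter.
  obtain ⟨Φ, hΦ⟩ := (convex_openSector hτ).exists_forall_hasDerivWithinAt hF
  have hΦ' : ∀ s ∈ openSector τ, HasDerivAt Φ (F s) s := fun s hs =>
    (hΦ s hs).hasDerivAt ((isOpen_openSector τ).mem_nhds hs)
  have ray : ∀ v : ℝ, |v| ≤ 1 → ∀ R : ℝ, 0 ≤ R →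
      ∫ ρ in (0 : ℝ)..R, F (ρ * (τ + v * Complex.I)) * (τ + v * Complex.I) =
        Φ (R * (τ + v * Complex.I)) - Φ 0 := by
    intro v hv R hR
    have hmem : ∀ ρ ∈ uIcc 0 R, (ρ : ℂ) * (τ + v * Complex.I) ∈ openSector τ := fun ρ hρ => by
      rw [uIcc_of_le hR] at hρ
      exact mem_openSector_of_abs_le_one hτ hρ.1 hv
    have := intervalIntegral.integral_eq_sub_of_hasDerivAt (a := 0) (b := R)
      (f := fun ρ : ℝ => Φ (ρ * (τ + v * Complex.I)))
      (f' := fun ρ : ℝ => F (ρ * (τ + v * Complex.I)) * (τ + v * Complex.I)) ?_ ?_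
    · simpa using this
    · intro ρ hρ
      have h1 : HasDerivAt (fun ρ : ℂ => ρ * (τ + v * Complex.I)) (τ + v * Complex.I) (ρ : ℂ) := by
        simpa using (hasDerivAt_id (ρ : ℂ)).mul_const (τ + v * Complex.I)
      exact ((hΦ' _ (hmem ρ hρ)).comp (ρ : ℂ) h1).comp_ofReal
    · refine ContinuousOn.intervalIntegrable ?_
      refine ContinuousOn.mul ?_ continuousOn_const
      exact hF.continuousOn.comp (by fun_prop) hmem
  -- The far ends are joined by a vertical segment of length `2R` on which `‖F‖ ≤ B R`.
  have hdiff : ∀ R : ℝ, 0 ≤ R → (∀ v : ℝ, |v| ≤ 1 → ‖F (R * (τ + v * Complex.I))‖ ≤ B R) →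
      ‖Φ (R * (τ + (1 : ℝ) * Complex.I)) - Φ (R * (τ + (-1 : ℝ) * Complex.I))‖ ≤ 2 * (R * B R) := by
    intro R hR hb
    have hd : ∀ v ∈ Icc (-1 : ℝ) 1, HasDerivWithinAt (fun v : ℝ => Φ (R * (τ + v * Complex.I)))
        (F (R * (τ + v * Complex.I)) * (R * Complex.I)) (Icc (-1 : ℝ) 1) v := by
      intro v hv
      have h1 : HasDerivAt (fun v : ℂ => R * (τ + v * Complex.I)) (R * Complex.I) (v : ℂ) := by
        simpa using (((hasDerivAt_id (v : ℂ)).mul_const Complex.I).const_add (τ : ℂ)).const_mul (R : ℂ)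
      exact (((hΦ' _ (mem_openSector_of_abs_le_one hτ hR (abs_le.2 hv))).comp (v : ℂ)
        h1).comp_ofReal).hasDerivWithinAt
    have := (convex_Icc (-1 : ℝ) 1).norm_image_sub_le_of_norm_hasDerivWithin_le (C := R * B R) hd
      (fun v hv => ?_) (left_mem_Icc.2 (by norm_num)) (right_mem_Icc.2 (by norm_num))
    · refine this.trans (le_of_eq ?_)
      norm_num [mul_comm]
    · rw [norm_mul, norm_mul, Complex.norm_I, mul_one, Complex.norm_of_nonneg hR, mul_comm]
      exact mul_le_mul_of_nonneg_left (hb v (abs_le.2 hv)) hR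
  have hB2 : Tendsto (fun R => 2 * (R * B R)) atTop (𝓝 0) := by simpa using hB.const_mul 2
  refine squeeze_zero_norm' ?_ hB2
  filter_upwards [hFB, eventually_ge_atTop 0] with R h1 h2
  rw [ray 1 (by simp) R h2, ray (-1) (by simp) R h2, sub_sub_sub_cancel_right]
  exact hdiff R h2 h1

/-- The contribution of a simple pole to the integral along the boundary of a sector. -/
theorem tendsto_integral_ray_pole {τ m : ℝ} (hτ : 0 < τ) (hm : 0 < m) :
    Tendsto (fun R : ℝ => (∫ ρ in (0 : ℝ)..R, (1 / (m - ρ * (τ + (1 : ℝ) * Complex.I)) +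
        1 / (1 + ρ * (τ + (1 : ℝ) * Complex.I))) * (τ + (1 : ℝ) * Complex.I)) -
      ∫ ρ in (0 : ℝ)..R, (1 / (m - ρ * (τ + (-1 : ℝ) * Complex.I)) +
        1 / (1 + ρ * (τ + (-1 : ℝ) * Complex.I))) * (τ + (-1 : ℝ) * Complex.I))
      atTop (𝓝 (2 * π * Complex.I)) := by
  have ray : ∀ v : ℝ, v ≠ 0 → ∀ R : ℝ, 0 ≤ R →
      ∫ ρ in (0 : ℝ)..R, (1 / (m - ρ * (τ + v * Complex.I)) +
        1 / (1 + ρ * (τ + v * Complex.I))) * (τ + v * Complex.I) =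
        Complex.log (1 + R * (τ + v * Complex.I)) - Complex.log (m - R * (τ + v * Complex.I)) +
          Complex.log m := by
    intro v hv R hR
    have s1 : ∀ ρ : ℝ, 0 ≤ ρ → 1 + ρ * (τ + v * Complex.I) ∈ Complex.slitPlane := by
      intro ρ hρ
      left
      simp
      positivity
    have s2 : ∀ ρ : ℝ, 0 ≤ ρ → m - ρ * (τ + v * Complex.I) ∈ Complex.slitPlane := by
      intro ρ hρ
      rcases hρ.eq_or_lt with rfl | h
      · left; simpa using hm
      · right; simp [h.ne', hv]
    have := intervalIntegral.integral_eq_sub_of_hasDerivAt (a := 0) (b := R)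
      (f := fun ρ : ℝ => Complex.log (1 + ρ * (τ + v * Complex.I)) -
        Complex.log (m - ρ * (τ + v * Complex.I)))
      (f' := fun ρ : ℝ => (1 / (m - ρ * (τ + v * Complex.I)) +
        1 / (1 + ρ * (τ + v * Complex.I))) * (τ + v * Complex.I)) ?_ ?_
    · rw [this]; simp
    · intro ρ hρ
      rw [uIcc_of_le hR] at hρ
      have h0 : HasDerivAt (fun ρ : ℂ => ρ * (τ + v * Complex.I)) (τ + v * Complex.I) (ρ : ℂ) := by
        simpa using (hasDerivAt_id (ρ : ℂ)).mul_const (τ + v * Complex.I)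
      have h1 := ((h0.const_add 1).clog (s1 ρ hρ.1)).comp_ofReal
      have h2 := ((h0.const_sub (m : ℂ)).clog (s2 ρ hρ.1)).comp_ofReal
      exact (h1.sub h2).congr_deriv (by ring)
    · refine ContinuousOn.intervalIntegrable ?_
      rw [uIcc_of_le hR]
      refine ContinuousOn.mul (ContinuousOn.add (continuousOn_const.div (by fun_prop) ?_)
        (continuousOn_const.div (by fun_prop) ?_)) continuousOn_const
      · exact fun ρ hρ => Complex.slitPlane_ne_zero (s2 ρ hρ.1)
      · exact fun ρ hρ => Complex.slitPlane_ne_zero (s1 ρ hρ.1)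
  have lim : ∀ v : ℝ, v ≠ 0 →
      Tendsto (fun R : ℝ => Complex.log (1 + R * (τ + v * Complex.I)) -
        Complex.log (m - R * (τ + v * Complex.I)) + Complex.log m) atTop
        (𝓝 (Complex.log (τ + v * Complex.I) - Complex.log (-(τ + v * Complex.I)) +
          Complex.log m)) := by
    intro v hv
    refine Tendsto.add_const _ ?_
    have hinv : Tendsto (fun R : ℝ => ((R⁻¹ : ℝ) : ℂ)) atTop (𝓝 0) := by
      have := (Complex.continuous_ofReal.tendsto 0).comp (tendsto_inv_atTop_zero (𝕜 := ℝ))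
      simpa [Function.comp_def] using this
    have e1 : Tendsto (fun R : ℝ => ((R⁻¹ : ℝ) : ℂ) + (τ + v * Complex.I)) atTop
        (𝓝 (τ + v * Complex.I)) := by simpa using hinv.add_const (τ + v * Complex.I)
    have e2 : Tendsto (fun R : ℝ => (m : ℂ) * ((R⁻¹ : ℝ) : ℂ) - (τ + v * Complex.I)) atTop
        (𝓝 (-(τ + v * Complex.I))) := by
      simpa using (hinv.const_mul (m : ℂ)).sub_const (τ + v * Complex.I)
    have l1 := e1.clog (by right; simpa using hv)
    have l2 := e2.clog (by right; simpa using hv)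
    refine (l1.sub l2).congr' ?_
    filter_upwards [eventually_gt_atTop 0] with R hR
    have hR' : (R : ℂ) ≠ 0 := by exact_mod_cast hR.ne'
    have a1 : 1 + R * (τ + v * Complex.I) =
        (R : ℂ) * (((R⁻¹ : ℝ) : ℂ) + (τ + v * Complex.I)) := by
      push_cast; field_simp
    have a2 : m - R * (τ + v * Complex.I) =
        (R : ℂ) * ((m : ℂ) * ((R⁻¹ : ℝ) : ℂ) - (τ + v * Complex.I)) := by
      push_cast; field_simp
    have n1 : ((R⁻¹ : ℝ) : ℂ) + (τ + v * Complex.I) ≠ 0 := fun h => by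
      have := congrArg Complex.im h; simp at this; exact hv this
    have n2 : (m : ℂ) * ((R⁻¹ : ℝ) : ℂ) - (τ + v * Complex.I) ≠ 0 := fun h => by
      have := congrArg Complex.im h; simp at this; exact hv this
    rw [a1, a2, Complex.log_ofReal_mul hR n1, Complex.log_ofReal_mul hR n2]
    ring
  have key := (lim 1 one_ne_zero).sub (lim (-1) (by norm_num))
  -- Each ray contributes `log ω - log (-ω)`, which is `πi` above the real axis and `-πi` below;
  -- `log m` cancels.
  have val : Complex.log (τ + (1 : ℝ) * Complex.I) - Complex.log (-(τ + (1 : ℝ) * Complex.I)) +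
      Complex.log m - (Complex.log (τ + (-1 : ℝ) * Complex.I) -
        Complex.log (-(τ + (-1 : ℝ) * Complex.I)) + Complex.log m) = 2 * π * Complex.I := by
    have p1 : Complex.log (-(τ + (1 : ℝ) * Complex.I)) =
        Complex.log (τ + (1 : ℝ) * Complex.I) - π * Complex.I := by
      rw [Complex.log, Complex.log, norm_neg, Complex.arg_neg_eq_arg_sub_pi_of_im_pos (by simp)]
      push_cast; ring
    have p2 : Complex.log (-(τ + (-1 : ℝ) * Complex.I)) =
        Complex.log (τ + (-1 : ℝ) * Complex.I) + π * Complex.I := by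
      rw [Complex.log, Complex.log, norm_neg, Complex.arg_neg_eq_arg_add_pi_of_im_neg (by simp)]
      push_cast; ring
    rw [p1, p2]; ring
  rw [val] at key
  refine key.congr' ?_
  filter_upwards [eventually_ge_atTop 0] with R hR
  rw [ray 1 one_ne_zero R hR, ray (-1) (by norm_num) R hR]

/-! ### Cauchy's formula for functions of small exponential type -/

theorem norm_ray_le {τ v : ℝ} (hτ : 0 < τ) (hτ1 : τ ≤ 1) (hv : |v| ≤ 1) :
    ‖(τ : ℂ) + v * Complex.I‖ ≤ 2 := by
  refine (norm_add_le _ _).trans ?_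
  rw [norm_mul, Complex.norm_I, Complex.norm_real, Complex.norm_real, Real.norm_eq_abs,
    Real.norm_eq_abs, abs_of_pos hτ]
  linarith

theorem ray_re (τ v ρ : ℝ) : ((ρ : ℂ) * (τ + v * Complex.I)).re = ρ * τ := by simp

theorem ray_im (τ v ρ : ℝ) : ((ρ : ℂ) * (τ + v * Complex.I)).im = ρ * v := by simp

/-- The point has norm at most `2R`, so `g` grows at most like `exp(ητR/2)`, while the exponential
factor decays like `exp(-ητR)`: half of the decay survives. -/
theorem norm_mul_exp_ray_le {τ η m A : ℝ} (hτ : 0 < τ) (hτ1 : τ ≤ 1) (hη : 0 < η)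
    {g : ℂ → ℂ} (hA : ∀ s ∈ openSector τ, ‖g s‖ ≤ A * Real.exp (η * τ / 4 * ‖s‖))
    {R v : ℝ} (hR : 0 ≤ R) (hv : |v| ≤ 1) :
    ‖g (R * (τ + v * Complex.I)) * Complex.exp (-η * (R * (τ + v * Complex.I) - m))‖ ≤
      A * Real.exp (η * m) * Real.exp (-(η * τ / 2) * R) := by
  have hA0 : 0 ≤ A := by
    have := (norm_nonneg _).trans (hA _ (mem_openSector_of_abs_le_one hτ hR hv))
    exact nonneg_of_mul_nonneg_left this (Real.exp_pos _)
  have h1 := hA _ (mem_openSector_of_abs_le_one hτ hR hv)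
  have h2 : ‖(R : ℂ) * (τ + v * Complex.I)‖ ≤ R * 2 := by
    rw [norm_mul, Complex.norm_of_nonneg hR]
    exact mul_le_mul_of_nonneg_left (norm_ray_le hτ hτ1 hv) hR
  have h3 : (-(η : ℂ) * (R * (τ + v * Complex.I) - m)).re = η * m - η * τ * R := by
    simp only [neg_mul, Complex.neg_re, Complex.sub_re, Complex.add_re,
      Complex.mul_re, Complex.ofReal_re, Complex.ofReal_im, Complex.I_re, Complex.I_im]
    ring
  rw [norm_mul, Complex.norm_exp, h3]
  calc _ ≤ A * Real.exp (η * τ / 4 * (R * 2)) * Real.exp (η * m - η * τ * R) := by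
        gcongr
        refine h1.trans ?_
        gcongr
    _ = _ := by
        have : Real.exp (η * τ / 4 * (R * 2)) * Real.exp (η * m - η * τ * R) =
            Real.exp (η * m) * Real.exp (-(η * τ / 2) * R) := by
          rw [← Real.exp_add, ← Real.exp_add]
          ring_nf
        linear_combination A * this

/-- For `ρ ≤ m/2` the real part is at least `m/2` because `τ ≤ 1`; for larger `ρ` the imaginary part
has size `ρ`. -/
theorem half_le_norm_sub_ray {τ m v ρ : ℝ} (hτ : 0 < τ) (hτ1 : τ ≤ 1) (hm : 0 < m) (hρ : 0 ≤ ρ)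
    (hv : |v| = 1) : m / 2 ≤ ‖(m : ℂ) - ρ * (τ + v * Complex.I)‖ := by
  have h1 := Complex.abs_re_le_norm ((m : ℂ) - ρ * (τ + v * Complex.I))
  have h2 := Complex.abs_im_le_norm ((m : ℂ) - ρ * (τ + v * Complex.I))
  rw [Complex.sub_re, ray_re, Complex.ofReal_re] at h1
  rw [Complex.sub_im, ray_im, Complex.ofReal_im, zero_sub, abs_neg, abs_mul, hv,
    abs_of_nonneg hρ] at h2
  have := le_abs_self (m - ρ * τ)
  rcases le_total ρ (m / 2) with h | h
  · nlinarith
  · linarith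

theorem integrableOn_ray {τ η m A : ℝ} (hτ : 0 < τ) (hτ1 : τ ≤ 1) (hη : 0 < η) (hm : 0 < m)
    {g : ℂ → ℂ} (hg : DifferentiableOn ℂ g (openSector τ))
    (hA : ∀ s ∈ openSector τ, ‖g s‖ ≤ A * Real.exp (η * τ / 4 * ‖s‖)) {v : ℝ} (hv : |v| = 1) :
    ContinuousOn (fun ρ : ℝ => g (ρ * (τ + v * Complex.I)) *
        Complex.exp (-η * (ρ * (τ + v * Complex.I) - m)) / (m - ρ * (τ + v * Complex.I)) *
        (τ + v * Complex.I)) (Ici 0) ∧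
    IntegrableOn (fun ρ : ℝ => g (ρ * (τ + v * Complex.I)) *
        Complex.exp (-η * (ρ * (τ + v * Complex.I) - m)) / (m - ρ * (τ + v * Complex.I)) *
        (τ + v * Complex.I)) (Ioi 0) := by
  have hc : ContinuousOn (fun ρ : ℝ => g (ρ * (τ + v * Complex.I)) *
        Complex.exp (-η * (ρ * (τ + v * Complex.I) - m)) / (m - ρ * (τ + v * Complex.I)) *
        (τ + v * Complex.I)) (Ici 0) := by
    refine ContinuousOn.mul (ContinuousOn.div (ContinuousOn.mul ?_ (by fun_prop)) (by fun_prop) ?_)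
      continuousOn_const
    · exact hg.continuousOn.comp (by fun_prop)
        fun ρ hρ => mem_openSector_of_abs_le_one hτ hρ hv.le
    · intro ρ hρ h
      have := half_le_norm_sub_ray hτ hτ1 hm hρ hv
      rw [h, norm_zero] at this
      linarith
  refine ⟨hc, ?_⟩
  have hdom : IntegrableOn (fun ρ : ℝ => A * Real.exp (η * m) / (m / 2) * 2 *
      Real.exp (-(η * τ / 2) * ρ)) (Ioi 0) :=
    (integrableOn_exp_mul_Ioi (by have := mul_pos hη hτ; linarith) 0).const_mul _
  refine Integrable.mono' hdom ((hc.mono Ioi_subset_Ici_self).aestronglyMeasurable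
    measurableSet_Ioi) ?_
  filter_upwards [ae_restrict_mem measurableSet_Ioi] with ρ hρ
  have h1 := norm_mul_exp_ray_le (m := m) hτ hτ1 hη hA (le_of_lt hρ) hv.le
  have h2 := half_le_norm_sub_ray hτ hτ1 hm (le_of_lt hρ) hv
  have h3 := norm_ray_le hτ hτ1 hv.le
  rw [norm_mul, norm_div]
  calc _ ≤ A * Real.exp (η * m) * Real.exp (-(η * τ / 2) * ρ) / (m / 2) * 2 := by
        have := (norm_nonneg _).trans h1
        gcongr
    _ = _ := by ring

/-- Cauchy's integral formula for an infinite sector and functions of small exponential type. -/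
theorem integral_ray_sub_integral_ray {τ η m A : ℝ} (hτ : 0 < τ) (hτ1 : τ ≤ 1) (hη : 0 < η)
    (hm : 0 < m) {g : ℂ → ℂ} (hg : DifferentiableOn ℂ g (openSector τ))
    (hA : ∀ s ∈ openSector τ, ‖g s‖ ≤ A * Real.exp (η * τ / 4 * ‖s‖)) :
    (∫ ρ in Ioi (0 : ℝ), g (ρ * (τ + (1 : ℝ) * Complex.I)) *
        Complex.exp (-η * (ρ * (τ + (1 : ℝ) * Complex.I) - m)) /
          (m - ρ * (τ + (1 : ℝ) * Complex.I)) * (τ + (1 : ℝ) * Complex.I)) -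
      (∫ ρ in Ioi (0 : ℝ), g (ρ * (τ + (-1 : ℝ) * Complex.I)) *
        Complex.exp (-η * (ρ * (τ + (-1 : ℝ) * Complex.I) - m)) /
          (m - ρ * (τ + (-1 : ℝ) * Complex.I)) * (τ + (-1 : ℝ) * Complex.I)) =
      2 * π * Complex.I * g m := by
  have hητ : 0 < η * τ := mul_pos hη hτ
  -- The factor `1 + s` lets the pole be subtracted as `1/(m - s) + 1/(1 + s)`, which is `O(|s|⁻²)`.
  -- `F` is the holomorphic remainder, with the singularity at `m` removed by `dslope`; the extra
  -- pole `-1` lies outside the sector.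
  set K : ℂ → ℂ := fun s => g s * Complex.exp (-η * (s - m)) * (1 + s) with hK
  set F : ℂ → ℂ := fun s => -dslope K m s / (1 + s) with hFdef
  have hmΩ : (m : ℂ) ∈ openSector τ := by
    simp only [openSector, mem_ofPred_eq, Complex.ofReal_im, Complex.ofReal_re, abs_zero, zero_mul]
    linarith
  have h1s : ∀ s ∈ openSector τ, 1 + s ≠ 0 := by
    intro s hs h
    have h1 := congrArg Complex.re h
    simp only [openSector, mem_ofPred_eq] at hs
    have := mul_nonneg (abs_nonneg s.im) hτ.le
    simp at h1
    linarith
  have hKd : DifferentiableOn ℂ K (openSector τ) :=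
    (hg.mul (by fun_prop)).mul (by fun_prop)
  have hFd : DifferentiableOn ℂ F (openSector τ) :=
    ((Complex.differentiableOn_dslope ((isOpen_openSector τ).mem_nhds hmΩ)).2 hKd).neg.div
      (by fun_prop) h1s
  have hKm : K m = g m * (1 + m) := by simp [hK]
  have hFeq : ∀ s ∈ openSector τ, s ≠ m → F s = g s * Complex.exp (-η * (s - m)) / (m - s) -
      g m * (1 / (m - s) + 1 / (1 + s)) := by
    intro s hs hsm
    have e1 : s - m ≠ 0 := sub_ne_zero.2 hsm
    have e2 : (m : ℂ) - s ≠ 0 := sub_ne_zero.2 hsm.symm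
    have e3 := h1s s hs
    simp only [hFdef]
    rw [dslope_of_ne _ hsm, slope_def_field, hKm, hK]
    have : s - m = -(m - s) := by ring
    rw [this]
    field_simp
    ring_nf
  have hT := tendsto_integral_ray_sub_integral_ray hτ hFd
    -- The first summand bounds the Cauchy kernel times `g`, the second bounds `g m * (1 + m) / ((m
    -- - s)(1 + s))`; both are `o(1/R)`.
    (B := fun R => A * Real.exp (η * m) * Real.exp (-(η * τ / 2) * R) / (R * τ / 2) +
      ‖g m‖ * ((1 + m) / ((R * τ / 2) * (R * τ)))) ?_ ?_
  rotate_left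
  · have t1 : Tendsto (fun R : ℝ => Real.exp (-(η * τ / 2) * R)) atTop (𝓝 0) := by
      refine Real.tendsto_exp_atBot.comp ?_
      exact tendsto_id.const_mul_atTop_of_neg (by linarith)
    have t2 : Tendsto (fun R : ℝ => A * Real.exp (η * m) * Real.exp (-(η * τ / 2) * R) / (τ / 2) +
        ‖g m‖ * ((1 + m) / ((τ / 2) * τ)) * R⁻¹) atTop (𝓝 0) := by
      simpa using ((t1.const_mul (A * Real.exp (η * m))).div_const (τ / 2)).add
        (tendsto_inv_atTop_zero.const_mul (‖g m‖ * ((1 + m) / ((τ / 2) * τ))))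
    refine t2.congr' ?_
    filter_upwards [eventually_gt_atTop 0] with R hR
    field_simp
  · filter_upwards [eventually_ge_atTop (2 * m / τ), eventually_gt_atTop 0] with R hR hR0 v hv
    have hRτ : 2 * m ≤ R * τ := by rwa [div_le_iff₀ hτ] at hR
    have hmem := mem_openSector_of_abs_le_one hτ hR0.le hv
    have hRτ0 : 0 < R * τ := mul_pos hR0 hτ
    have b1 : R * τ / 2 ≤ ‖(m : ℂ) - R * (τ + v * Complex.I)‖ := by
      have h1 := Complex.abs_re_le_norm ((m : ℂ) - R * (τ + v * Complex.I))
      rw [Complex.sub_re, ray_re, Complex.ofReal_re] at h1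
      have := neg_abs_le (m - R * τ)
      linarith
    have b2 : R * τ ≤ ‖1 + R * (τ + v * Complex.I)‖ := by
      have h1 := Complex.re_le_norm (1 + R * (τ + v * Complex.I))
      rw [Complex.add_re, ray_re, Complex.one_re] at h1
      linarith
    have hne : (R : ℂ) * (τ + v * Complex.I) ≠ m := by
      intro h
      rw [h, sub_self, norm_zero] at b1
      linarith
    have e1 : (m : ℂ) - R * (τ + v * Complex.I) ≠ 0 := sub_ne_zero.2 hne.symm
    have e2 := h1s _ hmem
    rw [hFeq _ hmem hne]
    refine (norm_sub_le _ _).trans (add_le_add ?_ ?_)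
    · rw [norm_div]
      have h1 := norm_mul_exp_ray_le (m := m) hτ hτ1 hη hA hR0.le hv
      have := (norm_nonneg _).trans h1
      gcongr
    · have : 1 / ((m : ℂ) - R * (τ + v * Complex.I)) + 1 / (1 + R * (τ + v * Complex.I)) =
          ((1 + m : ℝ) : ℂ) / ((m - R * (τ + v * Complex.I)) * (1 + R * (τ + v * Complex.I))) := by
        push_cast
        field_simp
        ring
      rw [this, norm_mul, norm_div, norm_mul, Complex.norm_of_nonneg (by linarith : 0 ≤ 1 + m)]
      gcongr
  have hP := (tendsto_integral_ray_pole hτ hm).const_mul (g m)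
  have hsum := hT.add hP
  rw [zero_add] at hsum
  have lim : ∀ v : ℝ, |v| = 1 → _ := fun v hv =>
    intervalIntegral_tendsto_integral_Ioi 0 (integrableOn_ray hτ hτ1 hη hm hg hA hv).2 tendsto_id
  have hI := (lim 1 (by simp)).sub (lim (-1) (by simp))
  refine (tendsto_nhds_unique hI (hsum.congr' ?_)).trans (mul_comm _ _)
  filter_upwards [eventually_ge_atTop 0] with R hR
  have ray : ∀ v : ℝ, |v| = 1 →
      (∫ ρ in (0 : ℝ)..R, F (ρ * (τ + v * Complex.I)) * (τ + v * Complex.I)) +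
        g m * (∫ ρ in (0 : ℝ)..R, (1 / (m - ρ * (τ + v * Complex.I)) +
          1 / (1 + ρ * (τ + v * Complex.I))) * (τ + v * Complex.I)) =
      ∫ ρ in (0 : ℝ)..R, g (ρ * (τ + v * Complex.I)) *
        Complex.exp (-η * (ρ * (τ + v * Complex.I) - m)) / (m - ρ * (τ + v * Complex.I)) *
        (τ + v * Complex.I) := by
    intro v hv
    have hne : ∀ ρ : ℝ, 0 ≤ ρ → (m : ℂ) - ρ * (τ + v * Complex.I) ≠ 0 := by
      intro ρ hρ h
      have := half_le_norm_sub_ray hτ hτ1 hm hρ hv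
      rw [h, norm_zero] at this
      linarith
    have hmem : ∀ ρ ∈ uIcc 0 R, (ρ : ℂ) * (τ + v * Complex.I) ∈ openSector τ := fun ρ hρ => by
      rw [uIcc_of_le hR] at hρ
      exact mem_openSector_of_abs_le_one hτ hρ.1 hv.le
    rw [← intervalIntegral.integral_const_mul, ← intervalIntegral.integral_add]
    · refine intervalIntegral.integral_congr fun ρ hρ => ?_
      have h0 := hmem ρ hρ
      rw [uIcc_of_le hR] at hρ
      rw [hFeq _ h0 (sub_ne_zero.1 (hne ρ hρ.1)).symm]
      ring
    · exact ((hFd.continuousOn.comp (by fun_prop) hmem).mul continuousOn_const).intervalIntegrable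
    · refine ContinuousOn.intervalIntegrable (continuousOn_const.mul (ContinuousOn.mul
        (ContinuousOn.add (continuousOn_const.div (by fun_prop) ?_)
        (continuousOn_const.div (by fun_prop) ?_)) continuousOn_const))
      · intro ρ hρ
        rw [uIcc_of_le hR] at hρ
        exact hne ρ hρ.1
      · exact fun ρ hρ => h1s _ (hmem ρ hρ)
  simp only [id]
  rw [← ray 1 (by simp), ← ray (-1) (by simp)]
  ring

/-! ### From the Cauchy kernel to values of the polynomial on spirals -/

/-- Replacing each `1/(m - s)` by its Laplace integral in the direction `κ` lets the sum over `n`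
collapse to one value of `p` on the spiral. The zero of `p` gives `exp(-(N + 1)u)` against
`exp(au)`, and `a = N + 1/2` leaves the integrable `exp(-u/2)`. -/
theorem norm_sum_exp_div_le {τ η a ρ v D : ℝ} (hτ : 0 < τ) (hτ1 : τ ≤ 1)
    (hv : |v| = 1) {N : ℕ} (ha : a = N + 1 / 2) {p : Polynomial ℂ}
    (hp : ∀ n ≤ N, p.coeff n = 0) {z : ℂ}
    (hD : ∀ u : ℝ, 0 ≤ u →
      ‖p.eval (Complex.exp (-(-η + u * (1 + τ * v * Complex.I))) * z)‖ ≤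
        D * Real.exp ((N + 1) * (η - u))) :
    ‖∑ n ∈ p.support, p.coeff n * z ^ n *
        (Complex.exp (-η * (ρ * (τ + v * Complex.I) - ((n - a : ℝ) : ℂ))) /
          (((n - a : ℝ) : ℂ) - ρ * (τ + v * Complex.I)))‖ ≤
      4 * D * Real.exp (η / 2) * Real.exp (-(η * τ) * ρ) := by
  -- Since `v² = 1`, the product `(τ + iv)(1 + iτv)` has real part `τ - τv² = 0`; hence `(s - m)κ`
  -- has real part `-m` for every `ρ`.
  set κ : ℂ := 1 + τ * v * Complex.I with hκ
  set s : ℂ := ρ * (τ + v * Complex.I) with hs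
  have hv2 : v * v = 1 := by rw [← abs_mul_abs_self, hv, one_mul]
  have hκre : κ.re = 1 := by simp [hκ]
  have hκ0 : κ ≠ 0 := fun h => by rw [h] at hκre; simp at hκre
  have hsκ : (s * κ).re = 0 := by
    simp [hs, hκ]
    linear_combination (-ρ * τ) * hv2
  have hsre : s.re = ρ * τ := by simp [hs]
  have hκn : ‖κ‖ ≤ 2 := by
    refine (norm_add_le _ _).trans ?_
    rw [norm_mul, norm_mul, Complex.norm_I, Complex.norm_real, Complex.norm_real,
      Real.norm_eq_abs, Real.norm_eq_abs, hv, abs_of_pos hτ, norm_one]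
    linarith
  have hre : ∀ n ∈ p.support, ((s - ((n - a : ℝ) : ℂ)) * κ).re < 0 := by
    intro n hn
    have hn' : N < n := by
      by_contra h
      exact Polynomial.mem_support_iff.1 hn (hp n (not_lt.1 h))
    have h1 : (N : ℝ) + 1 ≤ n := by exact_mod_cast hn'
    rw [sub_mul, Complex.sub_re, hsκ, Complex.re_ofReal_mul, hκre, ha]
    linarith
  have hterm : ∀ n ∈ p.support, p.coeff n * z ^ n *
      (Complex.exp (-η * (s - ((n - a : ℝ) : ℂ))) / (((n - a : ℝ) : ℂ) - s)) =
      ∫ u in Ioi (0 : ℝ), p.coeff n * z ^ n * (κ * Complex.exp (-η * (s - ((n - a : ℝ) : ℂ)))) *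
        Complex.exp ((s - ((n - a : ℝ) : ℂ)) * κ * u) := by
    intro n hn
    have h0 : (s - ((n - a : ℝ) : ℂ)) ≠ 0 := fun h => by
      have := hre n hn
      rw [h] at this
      simp at this
    have h0' : (((n - a : ℝ) : ℂ) - s) ≠ 0 := by rwa [← neg_sub, neg_ne_zero]
    rw [integral_const_mul, integral_exp_mul_complex_Ioi (hre n hn), Complex.ofReal_zero, mul_zero,
      Complex.exp_zero]
    have : s - ((n - a : ℝ) : ℂ) = -(((n - a : ℝ) : ℂ) - s) := by ring
    rw [this]
    field_simp
  rw [Finset.sum_congr rfl hterm, ← integral_finsetSum]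
  swap
  · exact fun n hn => (integrableOn_exp_mul_complex_Ioi (hre n hn) 0).const_mul _
  have hdom : IntegrableOn (fun u : ℝ => 2 * D * Real.exp (η / 2) * Real.exp (-(η * τ) * ρ) *
      Real.exp (-(1 / 2) * u)) (Ioi 0) :=
    (integrableOn_exp_mul_Ioi (by norm_num) 0).const_mul _
  refine (norm_integral_le_of_norm_le hdom ?_).trans (le_of_eq ?_)
  · filter_upwards [ae_restrict_mem measurableSet_Ioi] with u hu
    have e : ∑ n ∈ p.support, p.coeff n * z ^ n *
        (κ * Complex.exp (-η * (s - ((n - a : ℝ) : ℂ)))) *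
          Complex.exp ((s - ((n - a : ℝ) : ℂ)) * κ * u) =
        κ * Complex.exp ((a + s) * (-η + u * κ)) *
          p.eval (Complex.exp (-(-η + u * κ)) * z) := by
      rw [Polynomial.eval_eq_sum, Polynomial.sum, Finset.mul_sum]
      refine Finset.sum_congr rfl fun n _ => ?_
      rw [mul_pow, ← Complex.exp_nat_mul]
      have h1 : Complex.exp (-η * (s - ((n - a : ℝ) : ℂ))) *
          Complex.exp ((s - ((n - a : ℝ) : ℂ)) * κ * u) =
          Complex.exp ((a + s) * (-η + u * κ)) * Complex.exp (n * -(-η + u * κ)) := by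
        rw [← Complex.exp_add, ← Complex.exp_add]
        congr 1
        push_cast
        ring
      linear_combination (p.coeff n * z ^ n * κ) * h1
    have h2 : ((a + s) * (-η + u * κ)).re = -η * (a + ρ * τ) + u * a := by
      have : (a + s) * (-η + u * κ) = ((-η : ℝ) : ℂ) * (a + s) + ((u * a : ℝ) : ℂ) * κ +
          (u : ℂ) * (s * κ) := by push_cast; ring
      rw [this, Complex.add_re, Complex.add_re, Complex.re_ofReal_mul, Complex.re_ofReal_mul,
        Complex.re_ofReal_mul, hsκ, hκre, Complex.add_re, Complex.ofReal_re, hsre]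
      ring
    rw [e, norm_mul, norm_mul, Complex.norm_exp, h2]
    calc _ ≤ 2 * Real.exp (-η * (a + ρ * τ) + u * a) * (D * Real.exp ((N + 1) * (η - u))) := by
          have := hD u (le_of_lt hu)
          gcongr
      _ = 2 * D * (Real.exp (-η * (a + ρ * τ) + u * a) * Real.exp ((N + 1) * (η - u))) := by ring
      _ = 2 * D * (Real.exp (η / 2) * Real.exp (-(η * τ) * ρ) * Real.exp (-(1 / 2) * u)) := by
          rw [← Real.exp_add, ← Real.exp_add, ← Real.exp_add, ha]
          ring_nf
      _ = _ := by ring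
  · rw [integral_const_mul, integral_exp_mul_Ioi (by norm_num)]
    simp
    ring

/-- Cauchy's formula is summed against `p.coeff n * z ^ n` and the sum is moved under the ray
integral. The decay `exp(-ητρ)` of the summed kernel absorbs the growth `exp(ητρ/2)` of `g`. -/
theorem norm_sum_mul_coeff_le {τ η a A D : ℝ} (hτ : 0 < τ) (hτ1 : τ ≤ 1) (hη : 0 < η)
    {N : ℕ} (ha : a = N + 1 / 2) {g : ℂ → ℂ} (hg : DifferentiableOn ℂ g (openSector τ))
    (hA : ∀ s ∈ openSector τ, ‖g s‖ ≤ A * Real.exp (η * τ / 4 * ‖s‖))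
    {p : Polynomial ℂ} (hp : ∀ n ≤ N, p.coeff n = 0) {z : ℂ}
    (hD : ∀ v : ℝ, |v| = 1 → ∀ u : ℝ, 0 ≤ u →
      ‖p.eval (Complex.exp (-(-η + u * (1 + τ * v * Complex.I))) * z)‖ ≤
        D * Real.exp ((N + 1) * (η - u))) :
    ‖∑ n ∈ p.support, g ((n - a : ℝ) : ℂ) * p.coeff n * z ^ n‖ ≤
      32 * Real.exp (η / 2) / (η * τ) * A * D := by
  have hητ : 0 < η * τ := mul_pos hη hτ
  have hm : ∀ n ∈ p.support, (0 : ℝ) < n - a := by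
    intro n hn
    have hn' : N < n := by
      by_contra h
      exact Polynomial.mem_support_iff.1 hn (hp n (not_lt.1 h))
    have h1 : (N : ℝ) + 1 ≤ n := by exact_mod_cast hn'
    linarith
  have hA0 : 0 ≤ A := by
    have := (norm_nonneg _).trans (hA _
      (mem_openSector_of_abs_le_one hτ le_rfl (v := 1) (by simp)))
    exact nonneg_of_mul_nonneg_left this (Real.exp_pos _)
  have hI : ∀ v : ℝ, |v| = 1 → ‖∑ n ∈ p.support, p.coeff n * z ^ n *
      ∫ ρ in Ioi (0 : ℝ), g (ρ * (τ + v * Complex.I)) *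
        Complex.exp (-η * (ρ * (τ + v * Complex.I) - ((n - a : ℝ) : ℂ))) /
          (((n - a : ℝ) : ℂ) - ρ * (τ + v * Complex.I)) * (τ + v * Complex.I)‖ ≤
      16 * Real.exp (η / 2) / (η * τ) * A * D := by
    intro v hv
    simp_rw [← integral_const_mul]
    rw [← integral_finsetSum]
    swap
    · exact fun n hn => (integrableOn_ray hτ hτ1 hη (hm n hn) hg hA hv).2.const_mul _
    have hdom : IntegrableOn (fun ρ : ℝ => 8 * Real.exp (η / 2) * A * D *
        Real.exp (-(η * τ / 2) * ρ)) (Ioi 0) :=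
      (integrableOn_exp_mul_Ioi (by linarith) 0).const_mul _
    refine (norm_integral_le_of_norm_le hdom ?_).trans (le_of_eq ?_)
    · filter_upwards [ae_restrict_mem measurableSet_Ioi] with ρ hρ
      have hρ0 : 0 ≤ ρ := le_of_lt hρ
      have hQ := norm_sum_exp_div_le (ρ := ρ) hτ hτ1 hv ha hp (hD v hv)
      have hgb := hA _ (mem_openSector_of_abs_le_one hτ hρ0 hv.le)
      have hω := norm_ray_le hτ hτ1 hv.le
      have hωρ : ‖(ρ : ℂ) * (τ + v * Complex.I)‖ ≤ ρ * 2 := by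
        rw [norm_mul, Complex.norm_of_nonneg hρ0]
        exact mul_le_mul_of_nonneg_left hω hρ0
      have e : ∑ n ∈ p.support, p.coeff n * z ^ n * (g (ρ * (τ + v * Complex.I)) *
          Complex.exp (-η * (ρ * (τ + v * Complex.I) - ((n - a : ℝ) : ℂ))) /
            (((n - a : ℝ) : ℂ) - ρ * (τ + v * Complex.I)) * (τ + v * Complex.I)) =
          g (ρ * (τ + v * Complex.I)) * (τ + v * Complex.I) * ∑ n ∈ p.support, p.coeff n * z ^ n *
            (Complex.exp (-η * (ρ * (τ + v * Complex.I) - ((n - a : ℝ) : ℂ))) /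
              (((n - a : ℝ) : ℂ) - ρ * (τ + v * Complex.I))) := by
        rw [Finset.mul_sum]
        refine Finset.sum_congr rfl fun n _ => ?_
        ring
      rw [e, norm_mul, norm_mul]
      calc _ ≤ (A * Real.exp (η * τ / 4 * (ρ * 2))) * 2 *
            (4 * D * Real.exp (η / 2) * Real.exp (-(η * τ) * ρ)) := by
            gcongr
            refine hgb.trans ?_
            gcongr
        _ = 8 * Real.exp (η / 2) * A * D *
            (Real.exp (η * τ / 4 * (ρ * 2)) * Real.exp (-(η * τ) * ρ)) := by ring
        _ = _ := by
            rw [← Real.exp_add]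
            ring_nf
    · rw [integral_const_mul, integral_exp_mul_Ioi (by linarith)]
      simp
      field_simp
      ring
  have key : (2 * π * Complex.I) * ∑ n ∈ p.support, g ((n - a : ℝ) : ℂ) * p.coeff n * z ^ n =
      (∑ n ∈ p.support, p.coeff n * z ^ n *
        ∫ ρ in Ioi (0 : ℝ), g (ρ * (τ + (1 : ℝ) * Complex.I)) *
          Complex.exp (-η * (ρ * (τ + (1 : ℝ) * Complex.I) - ((n - a : ℝ) : ℂ))) /
            (((n - a : ℝ) : ℂ) - ρ * (τ + (1 : ℝ) * Complex.I)) * (τ + (1 : ℝ) * Complex.I)) -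
      ∑ n ∈ p.support, p.coeff n * z ^ n *
        ∫ ρ in Ioi (0 : ℝ), g (ρ * (τ + (-1 : ℝ) * Complex.I)) *
          Complex.exp (-η * (ρ * (τ + (-1 : ℝ) * Complex.I) - ((n - a : ℝ) : ℂ))) /
            (((n - a : ℝ) : ℂ) - ρ * (τ + (-1 : ℝ) * Complex.I)) * (τ + (-1 : ℝ) * Complex.I) := by
    rw [← Finset.sum_sub_distrib, Finset.mul_sum]
    refine Finset.sum_congr rfl fun n hn => ?_
    rw [← mul_sub, integral_ray_sub_integral_ray hτ hτ1 hη (hm n hn) hg hA]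
    ring
  have hn : ‖(2 * π * Complex.I : ℂ)‖ = 2 * π := by
    simp [abs_of_pos Real.pi_pos]
  have h1 : 2 * π * ‖∑ n ∈ p.support, g ((n - a : ℝ) : ℂ) * p.coeff n * z ^ n‖ ≤
      32 * Real.exp (η / 2) / (η * τ) * A * D := by
    rw [← hn, ← norm_mul, key]
    refine (norm_sub_le _ _).trans ((add_le_add (hI 1 (by simp)) (hI (-1) (by simp))).trans
      (le_of_eq ?_))
    ring
  have h2 : (1 : ℝ) ≤ 2 * π := by have := Real.pi_gt_three; linarith
  exact (le_mul_of_one_le_left (norm_nonneg _) h2).trans h1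

/-! ### Polynomials with their low-degree terms removed -/

theorem iteratedDeriv_polynomial (p : Polynomial ℂ) (n : ℕ) :
    iteratedDeriv n (fun z => p.eval z) = fun z => (Polynomial.derivative^[n] p).eval z := by
  induction n generalizing p with
  | zero => simp
  | succ n ih =>
    rw [iteratedDeriv_succ', Function.iterate_succ_apply, ← ih]
    congr 1
    ext z
    exact p.deriv

theorem norm_coeff_le {p : Polynomial ℂ} {R S : ℝ} (hR : 0 < R)
    (hS : ∀ w : ℂ, ‖w‖ = R → ‖p.eval w‖ ≤ S) (n : ℕ) : ‖p.coeff n‖ ≤ S / R ^ n := by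
  have h := Complex.norm_iteratedDeriv_le_of_forall_mem_sphere_norm_le (c := 0) (C := S) n hR
    p.differentiable.diffContOnCl (fun z hz => hS z (by simpa using hz))
  rw [iteratedDeriv_polynomial] at h
  beta_reduce at h
  rw [← Polynomial.coeff_zero_eq_eval_zero,
    Polynomial.coeff_iterate_derivative, zero_add, Nat.descFactorial_self, nsmul_eq_mul, norm_mul,
    Complex.norm_natCast, mul_div_assoc] at h
  exact le_of_mul_le_mul_left h (by positivity)

/-- The polynomial `p` without its terms of degree at most `N`. -/
noncomputable def polyTail (N : ℕ) (p : Polynomial ℂ) : Polynomial ℂ :=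
  p - ∑ n ∈ Finset.range (N + 1), Polynomial.monomial n (p.coeff n)

theorem coeff_polyTail (N : ℕ) (p : Polynomial ℂ) (n : ℕ) :
    (polyTail N p).coeff n = if n ≤ N then 0 else p.coeff n := by
  simp only [polyTail, Polynomial.coeff_sub, Polynomial.finsetSum_coeff,
    Polynomial.coeff_monomial, Finset.sum_ite_eq', Finset.mem_range, Nat.lt_succ_iff]
  split_ifs <;> simp

/-- Cauchy's inequalities on the disc of radius `R` control the removed terms, hence the tail on
`V`. The tail is divisible by `X ^ (N + 1)`, and its quotient is bounded directly where `‖w‖ ≥ R`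
and by the maximum principle inside the disc. -/
theorem norm_eval_polyTail_le {V : Set ℂ} {R M : ℝ} (hR : 0 < R)
    (hRV : Metric.closedBall 0 R ⊆ V) (hVM : ∀ w ∈ V, ‖w‖ ≤ M) (N : ℕ) :
    ∃ C : ℝ, 0 < C ∧ ∀ (p : Polynomial ℂ) (S : ℝ), (∀ w ∈ V, ‖p.eval w‖ ≤ S) →
      ∀ w ∈ V, ‖(polyTail N p).eval w‖ ≤ C * S * ‖w‖ ^ (N + 1) := by
  have h0 : (0 : ℂ) ∈ V := hRV (by simpa using hR.le)
  have hM : 0 ≤ M := (norm_nonneg _).trans (hVM 0 h0)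
  refine ⟨(1 + ∑ n ∈ Finset.range (N + 1), (M / R) ^ n) / R ^ (N + 1), by positivity, ?_⟩
  intro p S hS
  have hS0 : 0 ≤ S := (norm_nonneg _).trans (hS 0 h0)
  set C₁ : ℝ := 1 + ∑ n ∈ Finset.range (N + 1), (M / R) ^ n with hC₁
  have hC₁0 : 0 ≤ C₁ := by positivity
  have hcoef : ∀ n, ‖p.coeff n‖ ≤ S / R ^ n := norm_coeff_le hR
    fun w hw => hS w (hRV (by simp [hw]))
  have hcrude : ∀ w ∈ V, ‖(polyTail N p).eval w‖ ≤ C₁ * S := by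
    intro w hw
    rw [polyTail, Polynomial.eval_sub, Polynomial.eval_finsetSum, hC₁, add_mul, one_mul,
      Finset.sum_mul]
    refine (norm_sub_le _ _).trans (add_le_add (hS w hw) ((norm_sum_le _ _).trans
      (Finset.sum_le_sum fun n _ => ?_)))
    rw [Polynomial.eval_monomial, norm_mul, norm_pow]
    calc _ ≤ S / R ^ n * M ^ n := by
          gcongr
          · exact hcoef n
          · exact hVM w hw
      _ = _ := by rw [div_pow]; ring
  obtain ⟨h, hh⟩ : Polynomial.X ^ (N + 1) ∣ polyTail N p := by
    rw [Polynomial.X_pow_dvd_iff]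
    intro d hd
    rw [coeff_polyTail, if_pos (Nat.lt_succ_iff.1 hd)]
  have heval : ∀ w : ℂ, ‖(polyTail N p).eval w‖ = ‖w‖ ^ (N + 1) * ‖h.eval w‖ := by
    intro w
    rw [hh, Polynomial.eval_mul, Polynomial.eval_pow, Polynomial.eval_X, norm_mul, norm_pow]
  have hout : ∀ w ∈ V, R ≤ ‖w‖ → ‖h.eval w‖ ≤ C₁ / R ^ (N + 1) * S := by
    intro w hw hRw
    have h1 := hcrude w hw
    rw [heval] at h1
    have h2 : R ^ (N + 1) * ‖h.eval w‖ ≤ C₁ * S := le_trans (by gcongr) h1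
    rw [div_mul_eq_mul_div, le_div_iff₀ (by positivity), mul_comm]
    exact h2
  have hall : ∀ w ∈ V, ‖h.eval w‖ ≤ C₁ / R ^ (N + 1) * S := by
    intro w hw
    rcases le_total R ‖w‖ with hRw | hRw
    · exact hout w hw hRw
    · refine Complex.norm_le_of_forall_mem_frontier_norm_le (f := fun w => h.eval w)
        (U := Metric.ball 0 R) Metric.isBounded_ball h.differentiable.diffContOnCl (fun z hz => ?_)
        (by rw [closure_ball _ hR.ne']; simpa using hRw)
      rw [frontier_ball _ hR.ne'] at hz
      have hz' : ‖z‖ = R := by simpa using hz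
      exact hout z (hRV (by simp [hz'])) hz'.ge
  intro w hw
  rw [heval, mul_comm]
  gcongr
  exact hall w hw

/-! ### Symbols: pointwise bounds and translated sectors -/

variable {r : Ioo (0 : ℝ) (π / 2) → ℝ≥0}

theorem norm_toFun_le (γ : SymbolSpace r) (i : Ioo (0 : ℝ) (π / 2) × {ε : ℝ // 0 < ε})
    (z : sector i.1 (r i.1)) :
    ‖γ.toFun (sectorIncl r i.1 z)‖ ≤ symbolSeminorm r i γ * Real.exp (i.2 * ‖(z : ℂ)‖) := by
  have h : ‖γ.toFun (sectorIncl r i.1 z)‖ * Real.exp (-i.2 * ‖(z : ℂ)‖) ≤ symbolSeminorm r i γ :=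
    le_ciSup (γ.2.2 i.1 i.2) z
  rwa [neg_mul, Real.exp_neg, ← div_eq_mul_inv, div_le_iff₀ (Real.exp_pos _)] at h

theorem continuous_symbolSeminorm (i : Ioo (0 : ℝ) (π / 2) × {ε : ℝ // 0 < ε}) :
    Continuous (symbolSeminorm r i) :=
  (withSeminorms_symbolSeminorm r).continuous_seminorm i

/-- When `n > r(0)`, some `θ` has `r(θ) < n`, so a single seminorm controls the value. This handles
the finitely many `n` at most `N`, where the sector of the Cauchy formula is of no use. -/
theorem exists_norm_atNat_le (r : Ioo (0 : ℝ) (π / 2) → ℝ≥0) (n : ℕ) :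
    ∃ C : SymbolSpace r → ℝ, Continuous C ∧ C 0 = 0 ∧ ∀ γ, ‖γ.atNat n‖ ≤ C γ := by
  by_cases h : rZero r < n
  · obtain ⟨θ, hθ⟩ := exists_lt_of_ciInf_lt h
    have hmem : (n : ℂ) ∈ sector θ (r θ) :=
      ⟨by simpa using (by exact_mod_cast hθ : (r θ : ℝ) < n), by simpa using θ.2.1⟩
    refine ⟨fun γ => symbolSeminorm r (θ, ⟨1, one_pos⟩) γ * Real.exp (1 * ‖(n : ℂ)‖),
      (continuous_symbolSeminorm _).mul continuous_const, by simp, fun γ => ?_⟩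
    rw [SymbolSpace.atNat, dif_pos h]
    exact norm_toFun_le γ (θ, ⟨1, one_pos⟩) ⟨n, hmem⟩
  · refine ⟨0, continuous_const, rfl, fun γ => ?_⟩
    rw [SymbolSpace.atNat, dif_neg h]
    simp

/-- The angle of the sector bounded by the half-lines spanned by `τ + i` and `τ - i`. -/
noncomputable def sectorAngle {τ : ℝ} (hτ : 0 < τ) : Ioo (0 : ℝ) (π / 2) :=
  ⟨Real.arctan τ⁻¹, Real.arctan_pos.2 (inv_pos.2 hτ), Real.arctan_lt_pi_div_two _⟩

/-- With `a = ρ + 1/2`, the real part of `a + s` exceeds `ρ + 1/4 + |s.im| * τ`. This gives both the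
modulus bound and `|tan arg| < 1/τ`. -/
theorem add_mem_sector {τ a ρ : ℝ} {σ : ℝ≥0} (hτ : 0 < τ) (hσ : (σ : ℝ) ≤ ρ) (ha : a = ρ + 1 / 2)
    {s : ℂ} (hs : s ∈ openSector τ) : (a : ℂ) + s ∈ sector (sectorAngle hτ) σ := by
  have hσ0 : (0 : ℝ) ≤ σ := σ.2
  simp only [openSector, mem_ofPred_eq] at hs
  have hre : ((a : ℂ) + s).re = a + s.re := by simp
  have him : ((a : ℂ) + s).im = s.im := by simp
  have h0 : 0 ≤ |s.im| * τ := by positivity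
  have hpos : 0 < ((a : ℂ) + s).re := by rw [hre]; linarith
  refine ⟨lt_of_lt_of_le ?_ (Complex.re_le_norm _), ?_⟩
  · rw [hre]; linarith
  · have harg : Complex.arg (a + s) = Real.arctan (s.im / (a + s.re)) := by
      have h1 := abs_lt.1 (Complex.abs_arg_lt_pi_div_two_iff.2 (Or.inl hpos))
      rw [← hre, ← him, ← Complex.tan_arg, Real.arctan_tan h1.1 h1.2]
    have hlt : |s.im / (a + s.re)| < τ⁻¹ := by
      rw [abs_div, abs_of_pos (by rwa [hre] at hpos : 0 < a + s.re),
        div_lt_iff₀ (by rwa [hre] at hpos), ← div_eq_inv_mul, lt_div_iff₀ hτ]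
      linarith
    rw [harg, abs_lt]
    obtain ⟨h1, h2⟩ := abs_lt.1 hlt
    change -Real.arctan τ⁻¹ < _ ∧ _ < Real.arctan τ⁻¹
    rw [← Real.arctan_neg]
    exact ⟨Real.arctan_strictMono h1, Real.arctan_strictMono h2⟩

/-! ### Spirals in the thickening of a star-shaped set -/

/-- The rotation by angle `uτ` moves a point of modulus `exp(-u)` by at most `u exp(-u) τ ≤ τ`, so
the estimate is uniform in `u` although the spiral winds infinitely often. -/
theorem norm_exp_spiral_sub_le {τ η u v : ℝ} (hτ : 0 < τ) (hη : 0 < η) (hu : 0 ≤ u)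
    (hv : |v| = 1) :
    ‖Complex.exp (-(-η + u * (1 + τ * v * Complex.I))) - (Real.exp (-u) : ℂ)‖ ≤
      Real.exp η * τ + (Real.exp η - 1) := by
  have e : Complex.exp (-(-η + u * (1 + τ * v * Complex.I))) - (Real.exp (-u) : ℂ) =
      (Real.exp (-u) : ℂ) * ((Real.exp η : ℂ) *
        (Complex.exp (Complex.I * ((-(u * τ * v) : ℝ) : ℂ)) - 1) + ((Real.exp η - 1 : ℝ) : ℂ)) := by
    have : Complex.exp (-(-η + u * (1 + τ * v * Complex.I))) =
        Complex.exp (-u) * Complex.exp η * Complex.exp (Complex.I * ((-(u * τ * v) : ℝ) : ℂ)) := by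
      rw [← Complex.exp_add, ← Complex.exp_add]
      congr 1
      push_cast
      ring
    rw [this]
    push_cast
    ring
  have h1 : ‖Complex.exp (Complex.I * ((-(u * τ * v) : ℝ) : ℂ)) - 1‖ ≤ u * τ := by
    refine (Real.norm_exp_I_mul_ofReal_sub_one_le).trans (le_of_eq ?_)
    rw [norm_neg, Real.norm_eq_abs, abs_mul, hv, mul_one, abs_of_nonneg (by positivity)]
  have h2 : Real.exp (-u) ≤ 1 := Real.exp_le_one_iff.2 (by linarith)
  have h3 : Real.exp (-u) * u ≤ 1 := by
    rw [Real.exp_neg, ← div_eq_inv_mul, div_le_one (Real.exp_pos _)]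
    linarith [Real.add_one_le_exp u]
  have h4 : 0 ≤ Real.exp η - 1 := by linarith [Real.add_one_le_exp η]
  rw [e, norm_mul, Complex.norm_of_nonneg (Real.exp_pos _).le]
  calc _ ≤ Real.exp (-u) * (Real.exp η * (u * τ) + (Real.exp η - 1)) := by
        gcongr
        refine (norm_add_le _ _).trans ?_
        rw [norm_mul, Complex.norm_of_nonneg (Real.exp_pos _).le, Complex.norm_of_nonneg h4]
        gcongr
    _ = Real.exp η * τ * (Real.exp (-u) * u) + Real.exp (-u) * (Real.exp η - 1) := by ring
    _ ≤ Real.exp η * τ * 1 + 1 * (Real.exp η - 1) := by gcongr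
    _ = _ := by ring

theorem exists_spiral_parameter {d : ℝ} (hd : 0 < d) :
    ∃ τ : ℝ, 0 < τ ∧ τ ≤ 1 ∧ Real.exp τ * τ + (Real.exp τ - 1) < d := by
  have hc : Tendsto (fun τ : ℝ => Real.exp τ * τ + (Real.exp τ - 1)) (𝓝[>] 0) (𝓝 0) := by
    have : Continuous (fun τ : ℝ => Real.exp τ * τ + (Real.exp τ - 1)) := by fun_prop
    simpa using (this.tendsto 0).mono_left nhdsWithin_le_nhds
  obtain ⟨τ, h1, h2⟩ := ((hc.eventually_lt_const hd).and
    (Ioc_mem_nhdsGT (zero_lt_one (α := ℝ)))).exists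
  exact ⟨τ, h2.1, h2.2, h1⟩

theorem spiral_mul_mem_thickening {U : Set ℂ} (hU : StarConvex ℝ (0 : ℂ) U) {δ M τ : ℝ}
    (hτ : 0 < τ) (hM : 0 < M) (hd : Real.exp τ * τ + (Real.exp τ - 1) < δ / M)
    {z : ℂ} (hz : z ∈ U) (hzM : ‖z‖ ≤ M) {u v : ℝ} (hu : 0 ≤ u) (hv : |v| = 1) :
    Complex.exp (-(-τ + u * (1 + τ * v * Complex.I))) * z ∈ Metric.thickening δ U := by
  rw [Metric.mem_thickening_iff]
  refine ⟨(Real.exp (-u) : ℂ) * z, ?_, ?_⟩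
  · have := hU.smul_mem hz (Real.exp_pos (-u)).le (Real.exp_le_one_iff.2 (by linarith))
    simpa only [Complex.real_smul] using this
  · rw [dist_eq_norm, ← sub_mul, norm_mul]
    have h := norm_exp_spiral_sub_le hτ hτ hu hv
    calc _ ≤ (Real.exp τ * τ + (Real.exp τ - 1)) * M := by gcongr; exact (norm_nonneg _).trans h
      _ < δ / M * M := by gcongr
      _ = δ := div_mul_cancel₀ _ hM.ne'

/-! ### The estimate for polynomials -/

theorem eval_polyOperator (γ : SymbolSpace r) (f : Polynomial ℂ) (z : ℂ) :
    (polyOperator γ f).eval z = ∑ n ∈ f.support, γ.atNat n * f.coeff n * z ^ n := by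
  simp [polyOperator, Polynomial.eval_finsetSum]

theorem support_polyTail (N : ℕ) (p : Polynomial ℂ) :
    (polyTail N p).support = p.support.filter fun n => ¬ n ≤ N := by
  ext n
  simp only [Polynomial.mem_support_iff, coeff_polyTail, Finset.mem_filter]
  split_ifs with h <;> simp [h]

/-- The symbol, translated by `a`, extends to a function of small exponential type on a sector. -/
theorem exists_translate {τ a ε : ℝ} {N : ℕ} (hτ : 0 < τ) (hN : r (sectorAngle hτ) ≤ N)
    (ha : a = N + 1 / 2) (hε : 0 < ε) (γ : SymbolSpace r) :
    ∃ g : ℂ → ℂ, DifferentiableOn ℂ g (openSector τ) ∧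
      (∀ s ∈ openSector τ, ‖g s‖ ≤ symbolSeminorm r (sectorAngle hτ, ⟨ε, hε⟩) γ *
        Real.exp (ε * a) * Real.exp (ε * ‖s‖)) ∧
      ∀ n : ℕ, N < n → g ((n - a : ℝ) : ℂ) = γ.atNat n := by
  have hN' : ((r (sectorAngle hτ) : ℝ≥0) : ℝ) ≤ N := by exact_mod_cast hN
  obtain ⟨G, hG, hGγ⟩ := γ.2.1
  have hmem : ∀ s ∈ openSector τ, (a : ℂ) + s ∈ sector (sectorAngle hτ) (r (sectorAngle hτ)) :=
    fun s hs => add_mem_sector hτ hN' ha hs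
  have ha0 : 0 ≤ a := by rw [ha]; positivity
  refine ⟨fun s => G (a + s), hG.comp (by fun_prop) fun s hs => mem_iUnion.2 ⟨_, hmem s hs⟩,
    fun s hs => ?_, fun n hn => ?_⟩
  · have h1 := norm_toFun_le γ (sectorAngle hτ, ⟨ε, hε⟩) ⟨_, hmem s hs⟩
    have h2 : G (a + s) = γ.toFun (sectorIncl r (sectorAngle hτ) ⟨_, hmem s hs⟩) :=
      hGγ (sectorIncl r (sectorAngle hτ) ⟨_, hmem s hs⟩)
    beta_reduce
    rw [h2, mul_assoc, ← Real.exp_add, ← mul_add]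
    refine h1.trans ?_
    have h3 : ‖(a : ℂ) + s‖ ≤ a + ‖s‖ := by
      refine (norm_add_le _ _).trans ?_
      rw [Complex.norm_of_nonneg ha0]
    have h4 := apply_nonneg (symbolSeminorm r (sectorAngle hτ, ⟨ε, hε⟩)) γ
    gcongr
  · have hr0 : rZero r < n :=
      ((ciInf_le (OrderBot.bddBelow _) _).trans hN).trans_lt (by exact_mod_cast hn)
    rw [SymbolSpace.atNat, dif_pos hr0]
    have : (a : ℂ) + ((n - a : ℝ) : ℂ) = n := by push_cast; ring
    beta_reduce
    rw [this]
    exact hGγ ⟨n, natCast_mem_symbolDomain hr0⟩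

/-- The estimate for polynomials. -/
theorem exists_norm_eval_polyOperator_le (r : Ioo (0 : ℝ) (π / 2) → ℝ≥0) (U : BddOpen)
    (hU : StarConvex ℝ (0 : ℂ) U.carrier) {δ : ℝ} (hδ : 0 < δ) :
    ∃ C : SymbolSpace r → ℝ, Continuous C ∧ C 0 = 0 ∧ ∀ γ, 0 ≤ C γ ∧
      ∀ (f : Polynomial ℂ) (S : ℝ), (∀ w ∈ Metric.thickening δ U.carrier, ‖f.eval w‖ ≤ S) →
        ∀ z ∈ U.carrier, ‖(polyOperator γ f).eval z‖ ≤ C γ * S := by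
  have h0 : (0 : ℂ) ∈ U.carrier := hU.mem U.nonempty
  obtain ⟨M, hM, hVM⟩ : ∃ M : ℝ, 0 < M ∧ ∀ w ∈ Metric.thickening δ U.carrier, ‖w‖ ≤ M := by
    obtain ⟨M, hM⟩ := (U.isBounded.thickening (δ := δ)).exists_norm_le
    exact ⟨max M 1, by positivity, fun w hw => (hM w hw).trans (le_max_left _ _)⟩
  have hUV : U.carrier ⊆ Metric.thickening δ U.carrier := Metric.self_subset_thickening hδ _
  have hRV : Metric.closedBall (0 : ℂ) (δ / 2) ⊆ Metric.thickening δ U.carrier := by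
    intro w hw
    rw [Metric.mem_thickening_iff]
    exact ⟨0, h0, lt_of_le_of_lt hw (by linarith)⟩
  -- One parameter serves as both slope `τ` and exponential rate `η`; hence the growth rate `τ * τ /
  -- 4` demanded of the symbol below.
  obtain ⟨τ, hτ, hτ1, hd⟩ := exists_spiral_parameter (div_pos hδ hM)
  set N : ℕ := ⌈r (sectorAngle hτ)⌉₊ with hNdef
  have hN : r (sectorAngle hτ) ≤ N := Nat.le_ceil _
  obtain ⟨B, hB, hBf⟩ := norm_eval_polyTail_le (half_pos hδ) hRV hVM N
  choose c hc hc0 hcγ using exists_norm_atNat_le r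
  have hε : 0 < τ * τ / 4 := by positivity
  set a : ℝ := N + 1 / 2 with ha
  set i : Ioo (0 : ℝ) (π / 2) × {ε : ℝ // 0 < ε} := (sectorAngle hτ, ⟨τ * τ / 4, hε⟩) with hi
  set K : ℝ := 32 * Real.exp (τ / 2) / (τ * τ) * Real.exp (τ * τ / 4 * a) * B * M ^ (N + 1)
    with hK
  refine ⟨fun γ => ∑ n ∈ Finset.range (N + 1), c n γ * (M / (δ / 2)) ^ n + symbolSeminorm r i γ * K,
    ?_, ?_, fun γ => ⟨?_, fun f S hS z hz => ?_⟩⟩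
  · exact (continuous_finsetSum _ fun n _ => (hc n).mul continuous_const).add
      ((continuous_symbolSeminorm i).mul continuous_const)
  · simp only [hc0, zero_mul, Finset.sum_const_zero, map_zero, add_zero]
  · have : ∀ n, 0 ≤ c n γ := fun n => (norm_nonneg _).trans (hcγ n γ)
    exact add_nonneg (Finset.sum_nonneg fun n _ => mul_nonneg (this n) (by positivity))
      (mul_nonneg (apply_nonneg _ γ) (by positivity))
  · have hzM : ‖z‖ ≤ M := hVM z (hUV hz)
    have hS0 : 0 ≤ S := (norm_nonneg _).trans (hS z (hUV hz))
    obtain ⟨g, hg, hgA, hgn⟩ := exists_translate hτ hN ha hε γ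
    rw [eval_polyOperator, ← Finset.sum_filter_add_sum_filter_not f.support (· ≤ N), add_mul]
    refine (norm_add_le _ _).trans (add_le_add ?_ ?_)
    -- Degrees at most `N`: Cauchy's inequalities on the disc of radius `δ/2`, which lies in `U^δ`
    -- because `0 ∈ U`.
    · rw [Finset.sum_mul]
      refine (norm_sum_le _ _).trans ((Finset.sum_le_sum_of_subset_of_nonneg (fun n hn => ?_)
        fun n _ _ => norm_nonneg _).trans (Finset.sum_le_sum fun n _ => ?_))
      · exact Finset.mem_range.2 (Nat.lt_succ_of_le (Finset.mem_filter.1 hn).2)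
      · have h1 := norm_coeff_le (half_pos hδ) (fun w hw => hS w (hRV (by simp [hw]))) n
        have h2 := hcγ n γ
        rw [norm_mul, norm_mul, norm_pow]
        calc _ ≤ c n γ * (S / (δ / 2) ^ n) * M ^ n := by
              have := (norm_nonneg _).trans h2
              gcongr
          _ = _ := by rw [div_pow M]; ring
    -- Degrees above `N`: the contour estimate applied to the tail, whose zero at `0` supplies the
    -- required decay along the spiral.
    · have h := norm_sum_mul_coeff_le hτ hτ1 hτ ha hg hgA (p := polyTail N f) (z := z)
        (D := B * S * M ^ (N + 1)) (fun n hn => by rw [coeff_polyTail, if_pos hn]) ?_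
      · rw [support_polyTail] at h
        have e : ∑ n ∈ f.support with ¬ n ≤ N, γ.atNat n * f.coeff n * z ^ n =
            ∑ n ∈ f.support with ¬ n ≤ N,
              g ((n - a : ℝ) : ℂ) * (polyTail N f).coeff n * z ^ n := by
          refine Finset.sum_congr rfl fun n hn => ?_
          have hn' := (Finset.mem_filter.1 hn).2
          rw [coeff_polyTail, if_neg hn', hgn n (not_le.1 hn')]
        rw [e]
        refine h.trans (le_of_eq ?_)
        rw [hK]
        ring
      · intro v hv u hu
        refine (hBf f S hS _ (spiral_mul_mem_thickening hU hτ hM hd hz hzM hu hv)).trans ?_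
        have hE : ‖Complex.exp (-(-τ + u * (1 + τ * v * Complex.I)))‖ = Real.exp (τ - u) := by
          rw [Complex.norm_exp]
          congr 1
          simp
          ring
        rw [norm_mul, mul_pow, hE, ← Real.exp_nat_mul]
        push_cast
        calc _ ≤ B * S * (Real.exp ((N + 1) * (τ - u)) * M ^ (N + 1)) := by gcongr
          _ = _ := by ring

/-! ### Extension to entire functions -/

theorem atNat_add (γ₁ γ₂ : SymbolSpace r) (n : ℕ) :
    (γ₁ + γ₂).atNat n = γ₁.atNat n + γ₂.atNat n := by
  unfold SymbolSpace.atNat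
  split_ifs
  · rfl
  · simp

theorem hasSum_taylor {f : ℂ → ℂ} (hf : Differentiable ℂ f) (z : ℂ) :
    HasSum (fun n : ℕ => iteratedDeriv n f 0 / (n.factorial : ℂ) * z ^ n) (f z) := by
  refine (Complex.hasSum_taylorSeries_of_entire hf 0 z).congr_fun fun n => ?_
  rw [sub_zero, smul_eq_mul, smul_eq_mul]
  ring

theorem summable_norm_taylor {f : ℂ → ℂ} (hf : Differentiable ℂ f) (R : ℝ) :
    Summable fun n : ℕ => ‖iteratedDeriv n f 0 / (n.factorial : ℂ)‖ * R ^ n := by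
  have h := (hasSum_taylor hf (R : ℂ)).summable.norm
  refine Summable.of_norm (h.congr fun n => ?_)
  simp

/-- For large `n`, `‖γ(n)‖` is at most a constant times `eⁿ`, and the Taylor series of `f` still
converges absolutely at radius `e|R|`. -/
theorem summable_atNat_mul (γ : SymbolSpace r) {f : ℂ → ℂ} (hf : Differentiable ℂ f) (R : ℝ) :
    Summable fun n : ℕ =>
      ‖γ.atNat n * (iteratedDeriv n f 0 / (n.factorial : ℂ))‖ * R ^ n := by
  let θ : Ioo (0 : ℝ) (π / 2) := Classical.arbitrary _
  refine Summable.of_norm_bounded_eventually_nat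
    ((summable_norm_taylor hf (Real.exp 1 * |R|)).mul_left
      (symbolSeminorm r (θ, ⟨1, one_pos⟩) γ)) ?_
  filter_upwards [eventually_gt_atTop ⌈r θ⌉₊] with n hn
  have hn' : r θ < n := Nat.lt_of_ceil_lt hn
  have hmem : (n : ℂ) ∈ sector θ (r θ) :=
    ⟨by simpa using (by exact_mod_cast hn' : (r θ : ℝ) < n), by simpa using θ.2.1⟩
  have hr0 : rZero r < n := (ciInf_le (OrderBot.bddBelow _) _).trans_lt hn'
  have h1 : ‖γ.atNat n‖ ≤ symbolSeminorm r (θ, ⟨1, one_pos⟩) γ * Real.exp 1 ^ n := by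
    rw [SymbolSpace.atNat, dif_pos hr0]
    refine (norm_toFun_le γ (θ, ⟨1, one_pos⟩) ⟨n, hmem⟩).trans (le_of_eq ?_)
    simp [← Real.exp_nat_mul]
  rw [norm_mul, norm_norm, norm_mul, norm_pow, Real.norm_eq_abs]
  calc _ ≤ symbolSeminorm r (θ, ⟨1, one_pos⟩) γ * Real.exp 1 ^ n *
        ‖iteratedDeriv n f 0 / (n.factorial : ℂ)‖ * |R| ^ n := by gcongr
    _ = _ := by rw [mul_pow]; ring

theorem hasFPowerSeriesOnBall_tsum {c : ℕ → ℂ} (hc : ∀ R : ℝ, Summable fun n => ‖c n‖ * R ^ n) :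
    HasFPowerSeriesOnBall (fun z => ∑' n, c n * z ^ n) (FormalMultilinearSeries.ofScalars ℂ c) 0
      ⊤ := by
  have hr : (FormalMultilinearSeries.ofScalars ℂ c).radius = ⊤ :=
    FormalMultilinearSeries.radius_eq_top_of_summable_norm _ fun R => by
      simpa only [FormalMultilinearSeries.ofScalars_norm] using hc R
  have h := (FormalMultilinearSeries.ofScalars ℂ c).hasFPowerSeriesOnBall (by rw [hr]; simp)
  rw [hr] at h
  refine h.congr fun z _ => ?_
  simp only [FormalMultilinearSeries.sum, FormalMultilinearSeries.ofScalars_apply_eq, smul_eq_mul]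

/-- The entire function `H_γ f`. -/
noncomputable def entireOperator (γ : SymbolSpace r) (f : ℂ → ℂ) (z : ℂ) : ℂ :=
  ∑' n : ℕ, γ.atNat n * (iteratedDeriv n f 0 / (n.factorial : ℂ)) * z ^ n

theorem hasSum_entireOperator (γ : SymbolSpace r) {f : ℂ → ℂ} (hf : Differentiable ℂ f) (z : ℂ) :
    HasSum (fun n : ℕ => γ.atNat n * (iteratedDeriv n f 0 / (n.factorial : ℂ)) * z ^ n)
      (entireOperator γ f z) := by
  refine Summable.hasSum (Summable.of_norm ((summable_atNat_mul γ hf ‖z‖).congr fun n => ?_))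
  rw [norm_mul _ (z ^ n), norm_pow]

theorem entireOperator_mem (γ : SymbolSpace r) {f : ℂ → ℂ} (hf : Differentiable ℂ f) :
    entireOperator γ f ∈ entireSubmodule r := by
  have h := hasFPowerSeriesOnBall_tsum (summable_atNat_mul γ hf)
  refine ⟨fun z => ?_, fun j hj => ?_⟩
  · exact (h.differentiableOn z (by simp)).differentiableAt
      (Metric.isOpen_eball.mem_nhds (by simp))
  · have h1 := h.factorial_smul (1 : ℂ) j
    rw [FormalMultilinearSeries.ofScalars_apply_eq, ← iteratedDeriv_eq_iteratedFDeriv] at h1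
    -- The default value of `atNat` at `j ≤ r(0)` makes the low derivatives vanish.
    have h2 : γ.atNat j = 0 := by
      rw [SymbolSpace.atNat, dif_neg (not_lt.2 hj)]
    rw [h2] at h1
    change iteratedDeriv j (fun z => ∑' n, _) 0 = 0
    simpa using h1.symm

/-- The polynomial bound is applied to Taylor polynomials. Their sup on `V` exceeds `S` by at most a
Taylor tail that tends to `0`, so the constant `C` is preserved in the limit. -/
theorem norm_entireOperator_le (γ : SymbolSpace r) {V : Set ℂ} (hV : Bornology.IsBounded V)
    {z : ℂ} {C S : ℝ}
    (hC : ∀ (p : Polynomial ℂ) (S : ℝ), (∀ w ∈ V, ‖p.eval w‖ ≤ S) →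
      ‖(polyOperator γ p).eval z‖ ≤ C * S)
    {f : ℂ → ℂ} (hf : Differentiable ℂ f) (hS : ∀ w ∈ V, ‖f w‖ ≤ S) :
    ‖entireOperator γ f z‖ ≤ C * S := by
  obtain ⟨M, hM⟩ := hV.exists_norm_le
  set b : ℕ → ℂ := fun n => iteratedDeriv n f 0 / (n.factorial : ℂ) with hb
  set T : ℕ → Polynomial ℂ := fun K => ∑ n ∈ Finset.range K, Polynomial.monomial n (b n) with hT
  have hTc : ∀ K n, (T K).coeff n = if n < K then b n else 0 := by
    intro K n
    simp only [hT, Polynomial.finsetSum_coeff, Polynomial.coeff_monomial, Finset.sum_ite_eq',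
      Finset.mem_range]
  have hsum := summable_norm_taylor hf M
  have htail : ∀ K, ∀ w ∈ V, ‖(T K).eval w‖ ≤ S + ∑' n, ‖b (n + K)‖ * M ^ (n + K) := by
    intro K w hw
    have h1 := hasSum_taylor hf w
    have h2 := h1.summable.sum_add_tsum_nat_add K
    rw [h1.tsum_eq] at h2
    have h3 : (T K).eval w = f w - ∑' n, b (n + K) * w ^ (n + K) := by
      rw [← h2, add_sub_cancel_right, hT, Polynomial.eval_finsetSum]
      simp only [Polynomial.eval_monomial, hb]
    have h4 : ‖∑' n, b (n + K) * w ^ (n + K)‖ ≤ ∑' n, ‖b (n + K)‖ * M ^ (n + K) := by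
      refine tsum_of_norm_bounded ((summable_nat_add_iff K).2 hsum).hasSum fun n => ?_
      rw [norm_mul, norm_pow]
      gcongr
      exact hM w hw
    rw [h3]
    exact (norm_sub_le _ _).trans (add_le_add (hS w hw) h4)
  have hlim : Tendsto (fun K => (polyOperator γ (T K)).eval z) atTop
      (𝓝 (entireOperator γ f z)) := by
    refine (hasSum_entireOperator γ hf z).tendsto_sum_nat.congr fun K => ?_
    rw [eval_polyOperator]
    refine ((Finset.sum_subset (fun n hn => ?_) fun n _ hn => ?_).trans
      (Finset.sum_congr rfl fun n hn => ?_)).symm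
    · by_contra h
      rw [Polynomial.mem_support_iff, hTc, if_neg (by simpa using h)] at hn
      exact hn rfl
    · rw [Polynomial.notMem_support_iff.1 hn]
      simp
    · rw [hTc, if_pos (Finset.mem_range.1 hn)]
  have hlim2 : Tendsto (fun K => C * (S + ∑' n, ‖b (n + K)‖ * M ^ (n + K))) atTop
      (𝓝 (C * S)) := by
    simpa using ((tendsto_sum_nat_add fun n => ‖b n‖ * M ^ n).const_add S).const_mul C
  exact le_of_tendsto_of_tendsto' hlim.norm hlim2 fun K => hC _ _ (htail K)

theorem norm_le_supNorm (V : BddOpen) {f : ℂ → ℂ} (hf : Continuous f) :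
    ∀ w ∈ V.carrier, ‖f w‖ ≤ supNorm V.carrier f :=
  fun w hw => le_ciSup (bddAbove_norm V f hf) ⟨w, hw⟩

theorem supNorm_nonneg (V : Set ℂ) (f : ℂ → ℂ) : 0 ≤ supNorm V f :=
  Real.iSup_nonneg fun _ => norm_nonneg _

/-- `H_γ` as a linear map between spaces of entire functions. -/
noncomputable def entireLinearMap (γ : SymbolSpace r) (V U : BddOpen) :
    EntireSpace r V →ₗ[ℂ] EntireSpace r U where
  toFun f := ⟨entireOperator γ f.toFun, entireOperator_mem γ f.2.1⟩
  map_add' f g := Subtype.ext <| funext fun z => by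
    have hf : Differentiable ℂ f.toFun := f.2.1
    have hg : Differentiable ℂ g.toFun := g.2.1
    refine (hasSum_entireOperator γ (f + g).2.1 z).unique ?_
    refine ((hasSum_entireOperator γ hf z).add (hasSum_entireOperator γ hg z)).congr_fun ?_
    intro n
    change γ.atNat n * (iteratedDeriv n (f.toFun + g.toFun) 0 / _) * z ^ n = _
    rw [iteratedDeriv_add hf.contDiff.contDiffAt hg.contDiff.contDiffAt]
    change _ = γ.atNat n * (iteratedDeriv n f.toFun 0 / _) * z ^ n +
      γ.atNat n * (iteratedDeriv n g.toFun 0 / _) * z ^ n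
    ring
  map_smul' c f := Subtype.ext <| funext fun z => by
    have hf : Differentiable ℂ f.toFun := f.2.1
    refine (hasSum_entireOperator γ (c • f).2.1 z).unique ?_
    refine ((hasSum_entireOperator γ hf z).const_smul c).congr_fun ?_
    intro n
    change γ.atNat n * (iteratedDeriv n (c • f.toFun) 0 / _) * z ^ n = _
    rw [iteratedDeriv_const_smul hf.contDiff.contDiffAt c]
    change _ = c * (γ.atNat n * (iteratedDeriv n f.toFun 0 / _) * z ^ n)
    rw [smul_eq_mul]
    ring

end HolomorphyDefault

/-! ### The theorem -/

open HolomorphyDefault Filter Topology in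
theorem mainTheorem4 (r : Ioo (0 : ℝ) (π / 2) → ℝ≥0) (hr : Monotone r)
    (U : HolomorphyDefault.BddOpen) (hU : StarConvex ℝ (0 : ℂ) U.carrier)
    (δ : ℝ) (hδ : 0 < δ) :
    (∃ C : HolomorphyDefault.SymbolSpace r → ℝ, Continuous C ∧
      ∀ γ : HolomorphyDefault.SymbolSpace r, 0 < C γ ∧
        ∀ f : Polynomial ℂ,
          (∀ j : ℕ, j ≤ ⌊HolomorphyDefault.rZero r⌋₊ →
            (Polynomial.derivative^[j] f).eval 0 = 0) →
          HolomorphyDefault.supNorm U.carrier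
              (fun z => (HolomorphyDefault.polyOperator γ f).eval z) ≤
            C γ * HolomorphyDefault.supNorm (Metric.thickening δ U.carrier)
              (fun z => f.eval z)) ∧
    ∃ H : HolomorphyDefault.SymbolSpace r →
        (HolomorphyDefault.EntireSpace r (U.thickening δ hδ) →L[ℂ]
          HolomorphyDefault.EntireSpace r U),
      (∀ (γ : HolomorphyDefault.SymbolSpace r)
          (f : HolomorphyDefault.EntireSpace r (U.thickening δ hδ)) (z : ℂ),
        HasSum (fun n : ℕ => γ.atNat n * (iteratedDeriv n f.toFun 0 / (n.factorial : ℂ)) * z ^ n)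
          ((H γ f).toFun z)) ∧
      Continuous H := by
  obtain ⟨C, hC, hC0, hCγ⟩ := exists_norm_eval_polyOperator_le r U hU hδ
  constructor
  -- `C` vanishes at `γ = 0`; adding `1` makes the constant strictly positive.
  · refine ⟨fun γ => C γ + 1, hC.add continuous_const, fun γ =>
      ⟨by linarith [(hCγ γ).1], fun f _ => ?_⟩⟩
    have hV := supNorm_nonneg (Metric.thickening δ U.carrier) fun z => f.eval z
    have hle := (hCγ γ).2 f _ (norm_le_supNorm (U.thickening δ hδ) f.continuous)
    refine Real.iSup_le (fun z => (hle z z.2).trans ?_)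
      (mul_nonneg (by linarith [(hCγ γ).1]) hV)
    exact mul_le_mul_of_nonneg_right (by linarith) hV
  · have hbound : ∀ (γ : SymbolSpace r) (f : EntireSpace r (U.thickening δ hδ)),
        ‖entireLinearMap γ (U.thickening δ hδ) U f‖ ≤ C γ * ‖f‖ := by
      intro γ f
      refine Real.iSup_le (fun z => ?_) (mul_nonneg (hCγ γ).1 (norm_nonneg f))
      exact norm_entireOperator_le γ (U.thickening δ hδ).isBounded
        (fun p S hS => (hCγ γ).2 p S hS z z.2) f.2.1
        (norm_le_supNorm (U.thickening δ hδ) f.2.1.continuous)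
    set H : SymbolSpace r → (EntireSpace r (U.thickening δ hδ) →L[ℂ] EntireSpace r U) :=
      fun γ => (entireLinearMap γ (U.thickening δ hδ) U).mkContinuous (C γ) (hbound γ) with hH
    have hHs : ∀ (γ : SymbolSpace r) (f : EntireSpace r (U.thickening δ hδ)) (z : ℂ),
        HasSum (fun n : ℕ => γ.atNat n * (iteratedDeriv n f.toFun 0 / (n.factorial : ℂ)) * z ^ n)
          ((H γ f).toFun z) := fun γ f z => hasSum_entireOperator γ f.2.1 z
    have hadd : ∀ γ₁ γ₂ : SymbolSpace r, H (γ₁ + γ₂) = H γ₁ + H γ₂ := by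
      intro γ₁ γ₂
      refine ContinuousLinearMap.ext fun f => Subtype.ext <| funext fun z => ?_
      refine (hHs (γ₁ + γ₂) f z).unique (((hHs γ₁ f z).add (hHs γ₂ f z)).congr_fun fun n => ?_)
      rw [atNat_add]
      ring
    have : IsTopologicalAddGroup (SymbolSpace r) :=
      (withSeminorms_symbolSeminorm r).topologicalAddGroup
    refine ⟨H, hHs, continuous_iff_continuousAt.2 fun γ₀ => ?_⟩
    rw [ContinuousAt, tendsto_iff_norm_sub_tendsto_zero]
    -- By additivity `H γ - H γ₀ = H (γ - γ₀)`, whose norm is at most `C (γ - γ₀)`; continuity of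
    -- `C` with `C 0 = 0` finishes the argument.
    have hlim : Tendsto (fun γ => C (γ - γ₀)) (𝓝 γ₀) (𝓝 0) := by
      have h : Continuous fun γ => C (γ - γ₀) := hC.comp (continuous_id.sub continuous_const)
      simpa [hC0] using h.tendsto γ₀
    refine squeeze_zero (fun γ => norm_nonneg _) (fun γ => ?_) hlim
    have e : H γ - H γ₀ = H (γ - γ₀) := by
      rw [sub_eq_iff_eq_add, ← hadd, sub_add_cancel]
    rw [e]
    exact LinearMap.mkContinuous_norm_le _ (hCγ _).1 _
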